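/- **Model.** Let $1<R_0<R_1$. Let $N$ and $N^c$ be independent Poisson processes of rates $R_0$ and $R_c=R_1-R_0$ (packets from the free and from the costly server). For a stationary Markov policy $u:\mathbb R\to\{0,1\}$ and initial buffer size $D$, the buffer size is $$Q_t=D+N_t+\int_{(0,t]}u(Q_{s-})\,dN^c_s-t,\qquad t\ge 0 .$$ Put $\tau_0=\inf\{t\ge 0:Q_t=0\}$ (with $\inf\emptyset=\infty$). The policy is $(D,\epsilon)$-feasible if $P(\tau_0<\infty)\le\epsilon$. Its cost is $J^u(D,\epsilon)=\mathbb E\big[\int_0^{\tau_0}u(Q_t)\,dt\big]$ if it is $(D,\epsilon)$-feasible, and $J^u(D,\epsilon)=\infty$ otherwise. The risky policy $\pi^T$ is $\pi^T(q)=1$ if $0<q<T$ and $\pi^T(q)=0$ otherwise. Let $I(R)$ be the largest root of $\gamma(r)=r+R(e^{-r}-1)$, put $\alpha_0=I(R_0)$, $\alpha_1=I(R_1)$, and assume $\alpha_0<2$. Let $$\beta=\frac{\alpha_1}{\alpha_0(1-\alpha_0/2)},\qquad \bar D=\frac1{\alpha_1}\log\frac{\beta}{\epsilon},$$ $$T^*=\begin{cases}\dfrac{1}{\alpha_1-\alpha_0}\Big[\log\dfrac{\beta}{\epsilon}-\alpha_0D\Big],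 & D\ge\bar D,\\[2mm] \dfrac1{\alpha_1}\log\dfrac{\epsilon+\beta(1-e^{-\alpha_1D})-1}{\epsilon-e^{-\alpha_1D}}, & D\le\bar D\end{cases}$$ (the two formulas agree at $D=\bar D$). **Theorem.** Let $\epsilon>0$ and $\frac1{\alpha_1}\log\frac1\epsilon\le D\le\frac1{\alpha_0}\log\frac1\epsilon$. (1) If $D\ge\bar D$, then $$J^{\pi^{T^*}}(D,\epsilon)\le\frac{\beta}{\alpha_1(R_1-1)}\,e^{-\alpha_0(D-T^*)} .$$ (2) If $D\le\bar D$ and $D\ne\frac1{\alpha_1}\log\frac1\epsilon$ (so that $T^*$ is finite), then $$J^{\pi^{T^*}}(D,\epsilon)\le\frac{1-e^{-\alpha_1D}}{(R_1-1)(1-e^{-\alpha_1T^*})}\Big(T^*+1+\frac{\beta}{\alpha_1}\Big)-\frac{D}{R_1-1} .$$ -/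

import Mathlib

open MeasureTheory ProbabilityTheory Filter Topology
open scoped ENNReal

noncomputable section

/-- `I(R)`: the largest root of `γ(r) = r + R (e^{-r} - 1)`
(it is attained for every `R ≥ 0`, see `isGreatest_interruptionExponent`). -/
def interruptionExponent (R : ℝ) : ℝ :=
  sSup {r : ℝ | r + R * (Real.exp (-r) - 1) = 0}

theorem isGreatest_interruptionExponent {R : ℝ} (hR : 0 ≤ R) :
    IsGreatest {r : ℝ | r + R * (Real.exp (-r) - 1) = 0} (interruptionExponent R) := by
  have hb : BddAbove {r : ℝ | r + R * (Real.exp (-r) - 1) = 0} := by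
    refine ⟨R, fun r hr => ?_⟩
    have h1 : r + R * (Real.exp (-r) - 1) = 0 := hr
    nlinarith [mul_nonneg hR (Real.exp_pos (-r)).le]
  have hn : {r : ℝ | r + R * (Real.exp (-r) - 1) = 0}.Nonempty := ⟨0, by simp⟩
  have hc : IsClosed {r : ℝ | r + R * (Real.exp (-r) - 1) = 0} :=
    isClosed_eq (by fun_prop) continuous_const
  exact ⟨hc.csSup_mem hn hb, fun r hr => le_csSup hb hr⟩

/-! ### Poisson arrivals -/

/-- `X` is the sequence of interarrival times of a Poisson process of rate `r`: the `X n` are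
independent and exponentially distributed with rate `r`. The process itself is the counting
process `t ↦ arrivalCount (fun n => X n ω) t`. -/
structure IsPoissonInterarrival {Ω : Type*} [MeasurableSpace Ω] (X : ℕ → Ω → ℝ) (r : ℝ)
    (μ : Measure Ω) : Prop where
  hasLaw : ∀ n, HasLaw (X n) (expMeasure r) μ
  indep : iIndepFun X μ

/-- The time of arrival number `n` (counted from `0`), given the interarrival times `x`. -/
def arrivalTime (x : ℕ → ℝ) (n : ℕ) : ℝ := ∑ i ∈ Finset.range (n + 1), x i

/-- `N_t`: the number of arrivals in `[0, t]`. -/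
def arrivalCount (x : ℕ → ℝ) (t : ℝ) : ℕ := {n : ℕ | arrivalTime x n ≤ t}.ncard

/-- `N_{t-}`: the number of arrivals in `[0, t)`. -/
def arrivalCountBefore (x : ℕ → ℝ) (t : ℝ) : ℕ := {n : ℕ | arrivalTime x n < t}.ncard

/-! ### The controlled buffer -/

/-- The number of packets obtained from the costly server among its first `n` arrivals, when the
stationary Markov policy `u : ℝ → {0, 1}` is applied to the buffer size. Arrival number `n` of the
costly server, at time `s = arrivalTime y n`, is received if and only if `u (Q_{s-}) = 1`, where
`Q_{s-}` is the buffer size just before `s`. Here `x` and `y` are the interarrival times of the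
free and of the costly server. -/
def costlyReceived (u : ℝ → ℕ) (D : ℝ) (x y : ℕ → ℝ) : ℕ → ℕ
  | 0 => 0
  | n + 1 => costlyReceived u D x y n +
      u (D + arrivalCountBefore x (arrivalTime y n) + costlyReceived u D x y n - arrivalTime y n)

/-- The buffer size `Q_t = D + N_t + ∫_{(0,t]} u(Q_{s-}) dN^c_s - t`; see `bufferSize_eq`. -/
def bufferSize (u : ℝ → ℕ) (D : ℝ) (x y : ℕ → ℝ) (t : ℝ) : ℝ :=
  D + arrivalCount x t + costlyReceived u D x y (arrivalCount y t) - t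

theorem strictMono_arrivalTime {x : ℕ → ℝ} (hx : ∀ n, 0 < x n) : StrictMono (arrivalTime x) := by
  refine strictMono_nat_of_lt_succ fun n => ?_
  unfold arrivalTime
  rw [Finset.sum_range_succ _ (n + 1)]
  linarith [hx (n + 1)]

theorem ncard_initial {p : ℕ → Prop} (hp : ∀ m n, m ≤ n → p n → p m) (hf : ∃ n, ¬ p n) (n : ℕ) :
    n < {k : ℕ | p k}.ncard ↔ p n := by
  classical
  have h : {k : ℕ | p k} = Set.Iio (Nat.find hf) := by
    ext k
    simp only [Set.mem_ofPred_eq, Set.mem_Iio]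
    constructor
    · intro hk
      by_contra hle
      exact Nat.find_spec hf (hp _ _ (not_lt.mp hle) hk)
    · intro hk
      exact not_not.mp (Nat.find_min hf hk)
  have h2 : p n ↔ n ∈ {k : ℕ | p k} := Iff.rfl
  rw [h2, h]
  simp [Set.ncard_eq_toFinset_card']

theorem lt_arrivalCount {x : ℕ → ℝ} (hx : ∀ n, 0 < x n) (hx' : Tendsto (arrivalTime x) atTop atTop)
    (t : ℝ) (n : ℕ) : n < arrivalCount x t ↔ arrivalTime x n ≤ t := by
  refine ncard_initial (p := fun n => arrivalTime x n ≤ t)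
    (fun m n hmn h => ((strictMono_arrivalTime hx).monotone hmn).trans h) ?_ n
  obtain ⟨k, hk⟩ := (hx'.eventually_gt_atTop t).exists
  exact ⟨k, not_le.mpr hk⟩

theorem lt_arrivalCountBefore {x : ℕ → ℝ} (hx : ∀ n, 0 < x n)
    (hx' : Tendsto (arrivalTime x) atTop atTop)
    (t : ℝ) (n : ℕ) : n < arrivalCountBefore x t ↔ arrivalTime x n < t := by
  refine ncard_initial (p := fun n => arrivalTime x n < t)
    (fun m n hmn h => ((strictMono_arrivalTime hx).monotone hmn).trans_lt h) ?_ n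
  obtain ⟨k, hk⟩ := (hx'.eventually_gt_atTop t).exists
  exact ⟨k, not_lt.mpr hk.le⟩

theorem eventually_arrivalCount {x : ℕ → ℝ} (hx : ∀ n, 0 < x n)
    (hx' : Tendsto (arrivalTime x) atTop atTop) (s : ℝ) :
    ∀ᶠ t in 𝓝[<] s, arrivalCount x t = arrivalCountBefore x s := by
  have key : ∀ᶠ t in 𝓝[<] s, ∀ n ∈ Finset.range (arrivalCountBefore x s), arrivalTime x n < t := by
    rw [Filter.eventually_all_finset]
    intro n hn
    have h := (lt_arrivalCountBefore hx hx' s n).1 (Finset.mem_range.1 hn)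
    exact nhdsWithin_le_nhds (lt_mem_nhds h)
  filter_upwards [key, self_mem_nhdsWithin] with t ht hts
  have hts' : t < s := hts
  refine eq_of_forall_lt_iff fun n => ?_
  rw [lt_arrivalCount hx hx']
  constructor
  · intro h
    exact (lt_arrivalCountBefore hx hx' s n).2 (h.trans_lt hts')
  · intro h
    exact (ht n (Finset.mem_range.2 h)).le

/-- The buffer size solves the integral equation
`Q_t = D + N_t + ∫_{(0,t]} u(Q_{s-}) dN^c_s - t` on every path with positive interarrival times
and finitely many arrivals in bounded time (that is, almost surely). -/
theorem bufferSize_eq (u : ℝ → ℕ) (D : ℝ) {x y : ℕ → ℝ} (hx : ∀ n, 0 < x n) (hy : ∀ n, 0 < y n)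
    (hx' : Tendsto (arrivalTime x) atTop atTop) (hy' : Tendsto (arrivalTime y) atTop atTop)
    (t : ℝ) :
    bufferSize u D x y t = D + arrivalCount x t +
      ∑ n ∈ Finset.range (arrivalCount y t),
        (u (Function.leftLim (bufferSize u D x y) (arrivalTime y n)) : ℝ) - t := by
  have hlim : ∀ n, Function.leftLim (bufferSize u D x y) (arrivalTime y n) =
      D + arrivalCountBefore x (arrivalTime y n) + costlyReceived u D x y n - arrivalTime y n := by
    intro n
    have hn : arrivalCountBefore y (arrivalTime y n) = n := by
      refine eq_of_forall_lt_iff fun m => ?_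
      rw [lt_arrivalCountBefore hy hy', (strictMono_arrivalTime hy).lt_iff_lt]
    refine leftLim_eq_of_tendsto ?_
    have hc : Tendsto (fun t : ℝ => D + arrivalCountBefore x (arrivalTime y n) +
        costlyReceived u D x y n - t) (𝓝[<] (arrivalTime y n))
        (𝓝 (D + arrivalCountBefore x (arrivalTime y n) +
          costlyReceived u D x y n - arrivalTime y n)) :=
      (Continuous.tendsto (by fun_prop) _).mono_left nhdsWithin_le_nhds
    refine hc.congr' ?_
    filter_upwards [eventually_arrivalCount hx hx' (arrivalTime y n),
      eventually_arrivalCount hy hy' (arrivalTime y n)] with t h1 h2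
    rw [bufferSize, h1, h2, hn]
  have hsum : ∀ k, (costlyReceived u D x y k : ℝ) = ∑ n ∈ Finset.range k,
      (u (Function.leftLim (bufferSize u D x y) (arrivalTime y n)) : ℝ) := by
    intro k
    induction k with
    | zero => simp [costlyReceived]
    | succ k ih => rw [Finset.sum_range_succ, ← ih, hlim k, costlyReceived]; push_cast; rfl
  rw [← hsum, bufferSize]

/-! ### Interruption and cost -/

/-- `τ₀ = inf {t ≥ 0 : Q_t = 0}`, equal to `⊤` when the buffer never empties. -/
def interruptionTime (q : ℝ → ℝ) : EReal :=
  sInf ((fun t : ℝ => (t : EReal)) '' {t : ℝ | 0 ≤ t ∧ q t = 0})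

section Cost

variable {Ω : Type*} [MeasurableSpace Ω]

/-- The interruption probability `p^u(D) = P(τ₀ < ∞)`. -/
def interruptionProb (μ : Measure Ω) (X Y : ℕ → Ω → ℝ) (u : ℝ → ℕ) (D : ℝ) : ℝ≥0∞ :=
  μ {ω | interruptionTime (bufferSize u D (fun n => X n ω) (fun n => Y n ω)) < ⊤}

/-- The policy `u` is `(D, ε)`-feasible if its interruption probability is at most `ε`. -/
def IsFeasible (μ : Measure Ω) (X Y : ℕ → Ω → ℝ) (u : ℝ → ℕ) (D ε : ℝ) : Prop :=
  interruptionProb μ X Y u D ≤ ENNReal.ofReal ε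

/-- The expected usage time of the costly server, `E[∫₀^{τ₀} u(Q_t) dt]`. -/
def expectedUsage (μ : Measure Ω) (X Y : ℕ → Ω → ℝ) (u : ℝ → ℕ) (D : ℝ) : ℝ≥0∞ :=
  ∫⁻ ω, ∫⁻ t in {t : ℝ | 0 ≤ t ∧
      (t : EReal) < interruptionTime (bufferSize u D (fun n => X n ω) (fun n => Y n ω))},
    (u (bufferSize u D (fun n => X n ω) (fun n => Y n ω) t) : ℝ≥0∞) ∂volume ∂μ

open scoped Classical in
/-- The cost `J^u(D, ε)`: the expected usage time of the costly server if `u` is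
`(D, ε)`-feasible, and infinite otherwise. -/
def policyCost (μ : Measure Ω) (X Y : ℕ → Ω → ℝ) (u : ℝ → ℕ) (D ε : ℝ) : ℝ≥0∞ :=
  if IsFeasible μ X Y u D ε then expectedUsage μ X Y u D else ⊤

end Cost

/-! ### The risky policy -/

open scoped Classical in
/-- The risky policy `π^T`: use the costly server exactly when `0 < Q_t < T`. -/
def riskyPolicy (T : ℝ) (q : ℝ) : ℕ := if 0 < q ∧ q < T then 1 else 0

/-- `β = α₁ / (α₀ (1 - α₀ / 2))`, with `α₀ = I(R₀)` and `α₁ = I(R₁)`. -/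
def riskyBeta (R₀ R₁ : ℝ) : ℝ :=
  interruptionExponent R₁ / (interruptionExponent R₀ * (1 - interruptionExponent R₀ / 2))

/-- `D̄ = (1 / α₁) log (β / ε)`. -/
def criticalBuffer (R₀ R₁ ε : ℝ) : ℝ :=
  1 / interruptionExponent R₁ * Real.log (riskyBeta R₀ R₁ / ε)

open scoped Classical in
/-- The threshold `T*`. -/
def riskyThreshold (R₀ R₁ D ε : ℝ) : ℝ :=
  if criticalBuffer R₀ R₁ ε ≤ D then
    1 / (interruptionExponent R₁ - interruptionExponent R₀) *
      (Real.log (riskyBeta R₀ R₁ / ε) - interruptionExponent R₀ * D)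
  else
    1 / interruptionExponent R₁ *
      Real.log ((ε + riskyBeta R₀ R₁ * (1 - Real.exp (-(interruptionExponent R₁ * D))) - 1) /
        (ε - Real.exp (-(interruptionExponent R₁ * D))))

/-- The region `𝓡 = {(D, ε) : (1/α₁) log (1/ε) ≤ D ≤ (1/α₀) log (1/ε)}`. -/
def qoeRegion (R₀ R₁ : ℝ) : Set (ℝ × ℝ) :=
  {p | 0 < p.2 ∧ 1 / interruptionExponent R₁ * Real.log (1 / p.2) ≤ p.1 ∧
    p.1 ≤ 1 / interruptionExponent R₀ * Real.log (1 / p.2)}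

end

/-!
Write `α₀ = I(R₀)` and `α₁ = I(R₁)`. Both the interruption probability and the expected usage of
`π^T` are instances of one functional: the mean of a running cost `c (Q_t)` accumulated until the
interruption, plus an amount `b` paid at the interruption. Such a mean is bounded by any
nonnegative solution `V` of the backward inequality `c + R₀ (V(·+1) - V) +
(R₁ - R₀) (V(·+u) - V) - V' ≤ 0` with `b ≤ V(0)`, and it remains to exhibit good ones.

*Comparison.* The system is restarted at the first arrival of either server. By memorylessness
of the exponential law (`lintegral_restart`), what follows is an independent copy of the system
from the buffer size right after that arrival (`bufferSize_after`), so the mean costs up to the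
arrival number `n` satisfy a renewal inequality (`meanTruncCost_succ_le`). Its solutions dominate
these means by induction on `n` (`meanTruncCost_le`). Arrivals do not accumulate, so the total
cost of a path is the supremum of its truncated costs (`cost_le_iSup_truncCost`). Only right
derivatives enter in the passage from the backward inequality to the renewal inequality
(`lintegral_renewal_le`), so `V` may have a kink at the threshold.

*Barriers.* Since `α₀` and `α₁` are roots of `γ`, the function `exp (-α₀ p)` is harmonic above the
threshold `T`, the functions `1` and `exp (-α₁ p)` are harmonic below it, and `-p / (R₁ - 1)` pays
for the running cost below it. These are glued continuously at `T` (`barrier`). The glued function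
is a solution as soon as its upper branch lies below the continuation of its lower branch on
`[T, T + 1]`, which is as far as a packet can jump (`barrier_renewal_le`). By the inequality
`1 - exp (-α₀ x) ≥ α₀ (1 - α₀ / 2) x` on `[0, 1]`, this is what the factor `β` ensures
(`mul_le_riskyBeta_mul`).

The barrier equal to `1` at the empty buffer bounds the interruption probability
(`interruptionProb_riskyPolicy_le`), and the threshold `T*` makes this bound at most `ε`
(`threshold_of_critical_le`, `threshold_of_lt_critical`). The barrier vanishing at the empty buffer
bounds the expected usage (`expectedUsage_riskyPolicy_le`); below the critical buffer size its value
is even smaller than the asserted one, with `T + β / α₁` in place of `T + 1 + β / α₁`.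
-/

noncomputable section

/-! ### Exponential interarrival times -/

lemma lintegral_expMeasure (r : ℝ) {f : ℝ → ℝ≥0∞} (hf : Measurable f) :
    ∫⁻ x, f x ∂expMeasure r =
      ∫⁻ x in Set.Ici 0, ENNReal.ofReal (r * Real.exp (-(r * x))) * f x := by
  have h : expMeasure r = volume.withDensity (exponentialPDF r) := rfl
  have hm : Measurable (exponentialPDF r) := (measurable_exponentialPDFReal r).ennreal_ofReal
  rw [h, lintegral_withDensity_eq_lintegral_mul _ hm hf, ← lintegral_indicator measurableSet_Ici]
  refine lintegral_congr fun x => ?_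
  by_cases hx : 0 ≤ x
  · rw [Set.indicator_of_mem (Set.mem_Ici.2 hx), Pi.mul_apply, exponentialPDF_of_nonneg hx]
  · rw [Set.indicator_of_notMem (by simpa using hx), Pi.mul_apply,
      exponentialPDF_of_neg (not_le.1 hx), zero_mul]

/-- Memorylessness of the exponential law. -/
lemma lintegral_expMeasure_Ici {r a : ℝ} (ha : 0 ≤ a) {f : ℝ → ℝ≥0∞} (hf : Measurable f) :
    ∫⁻ x, (Set.Ici a).indicator (fun x => f (x - a)) x ∂expMeasure r =
      ENNReal.ofReal (Real.exp (-(r * a))) * ∫⁻ x, f x ∂expMeasure r := by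
  have hfa : Measurable fun x => f (x - a) := hf.comp (measurable_id.sub_const a)
  rw [lintegral_expMeasure r (hfa.indicator measurableSet_Ici),
    lintegral_expMeasure r hf, ← lintegral_const_mul _ (by fun_prop),
    ← lintegral_indicator measurableSet_Ici, ← lintegral_indicator measurableSet_Ici,
    ← lintegral_sub_right_eq_self ((Set.Ici 0).indicator fun x =>
      ENNReal.ofReal (Real.exp (-(r * a))) * (ENNReal.ofReal (r * Real.exp (-(r * x))) * f x)) a]
  refine lintegral_congr fun x => ?_
  by_cases h : a ≤ x
  · rw [Set.indicator_of_mem (Set.mem_Ici.2 (ha.trans h)),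
      Set.indicator_of_mem (Set.mem_Ici.2 h),
      Set.indicator_of_mem (Set.mem_Ici.2 (sub_nonneg.2 h)), ← mul_assoc,
      ← ENNReal.ofReal_mul (Real.exp_pos _).le]
    congr 2
    rw [mul_left_comm, ← Real.exp_add]
    ring_nf
  · have h1 : x - a ∉ Set.Ici (0 : ℝ) := by simpa using h
    rw [Set.indicator_of_notMem h1]
    by_cases h2 : x ∈ Set.Ici (0 : ℝ)
    · rw [Set.indicator_of_mem h2, Set.indicator_of_notMem (by simpa using h), mul_zero]
    · rw [Set.indicator_of_notMem h2]

lemma expMeasure_Ici {r : ℝ} (hr : 0 < r) {a : ℝ} (ha : 0 ≤ a) :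
    expMeasure r (Set.Ici a) = ENNReal.ofReal (Real.exp (-(r * a))) := by
  have := isProbabilityMeasure_expMeasure hr
  have h := lintegral_expMeasure_Ici (r := r) ha (f := fun _ => 1) measurable_const
  rwa [lintegral_indicator measurableSet_Ici, setLIntegral_one, lintegral_one, measure_univ,
    mul_one] at h

lemma ae_nonneg_expMeasure (r : ℝ) : ∀ᵐ x ∂expMeasure r, 0 ≤ x := by
  have h : expMeasure r {x | ¬ 0 ≤ x} = 0 := by
    have hs : MeasurableSet {x : ℝ | ¬ 0 ≤ x} := measurableSet_Ici.compl
    rw [← lintegral_indicator_one hs, lintegral_expMeasure r (measurable_one.indicator hs)]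
    rw [setLIntegral_congr_fun (g := fun _ => 0) measurableSet_Ici, lintegral_zero]
    intro x hx
    have hx' : 0 ≤ x := hx
    simp [hx']
  exact h

/-! ### Sequences of independent interarrival times -/

/-- The law of a sequence of independent exponential variables of rate `r`. -/
def interarrivalLaw (r : ℝ) : Measure (ℕ → ℝ) := by
  classical exact Measure.infinitePi fun _ => expMeasure r

/-- The sequence with first term `a` and remaining terms `x`. -/
def consSeq (a : ℝ) (x : ℕ → ℝ) : ℕ → ℝ
  | 0 => a
  | n + 1 => x n

@[simp] lemma consSeq_zero (a : ℝ) (x : ℕ → ℝ) : consSeq a x 0 = a := rfl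
@[simp] lemma consSeq_succ (a : ℝ) (x : ℕ → ℝ) (n : ℕ) : consSeq a x (n + 1) = x n := rfl

@[fun_prop]
lemma Measurable.consSeq {γ : Type*} [MeasurableSpace γ] {f : γ → ℝ} {g : γ → ℕ → ℝ}
    (hf : Measurable f) (hg : Measurable g) : Measurable fun z => consSeq (f z) (g z) := by
  refine measurable_pi_lambda _ fun n => ?_
  cases n with
  | zero => exact hf
  | succ n => exact (measurable_pi_apply n).comp hg

section Law

variable {r : ℝ}

lemma isProbabilityMeasure_interarrivalLaw (hr : 0 < r) :
    IsProbabilityMeasure (interarrivalLaw r) := by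
  have := isProbabilityMeasure_expMeasure hr
  unfold interarrivalLaw
  infer_instance

/-- A sequence of independent exponential variables is an exponential variable followed by an
independent sequence with the same law. -/
lemma map_consSeq_interarrivalLaw (hr : 0 < r) :
    ((expMeasure r).prod (interarrivalLaw r)).map (fun p => consSeq p.1 p.2) =
      interarrivalLaw r := by
  have := isProbabilityMeasure_expMeasure hr
  have := isProbabilityMeasure_interarrivalLaw hr
  refine Measure.eq_infinitePi (fun _ => expMeasure r) fun s t ht => ?_
  -- The box is shrunk to the whole space off `s`, so that its sides may be split as a product.
  let t' : ℕ → Set ℝ := fun i => if i ∈ s then t i else Set.univ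
  have ht' : ∀ i, MeasurableSet (t' i) := fun i => by
    by_cases h : i ∈ s <;> simp [t', h, ht]
  let m := s.sup id
  have hm : ∀ i ∈ s, i < m + 1 := fun i hi => Nat.lt_succ_of_le (Finset.le_sup (f := id) hi)
  have h1 : (fun p : ℝ × (ℕ → ℝ) => consSeq p.1 p.2) ⁻¹' (Set.pi s t) =
      t' 0 ×ˢ Set.pi (Finset.range m : Set ℕ) (fun i => t' (i + 1)) := by
    ext p
    simp only [Set.mem_preimage, Set.mem_pi, Set.mem_prod, Finset.mem_coe, Finset.mem_range]
    constructor
    · intro h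
      refine ⟨?_, fun i _ => ?_⟩
      · by_cases h0 : 0 ∈ s
        · simpa [t', h0] using h 0 h0
        · simp [t', h0]
      · by_cases h0 : i + 1 ∈ s
        · simpa [t', h0] using h (i + 1) h0
        · simp [t', h0]
    · rintro ⟨h0, hs⟩ i hi
      cases i with
      | zero => simpa [t', hi] using h0
      | succ i =>
        have := hs i (by have := hm _ hi; omega)
        simpa [t', hi] using this
  rw [Measure.map_apply (by fun_prop) (MeasurableSet.pi s.countable_toSet fun i _ => ht i), h1,
    Measure.prod_prod, interarrivalLaw, Measure.infinitePi_pi _ (fun i _ => ht' (i + 1)),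
    mul_comm, ← Finset.prod_range_succ' (fun i => expMeasure r (t' i))]
  refine (Finset.prod_subset_one_on_sdiff (fun i hi => Finset.mem_range.2 (hm i hi)) ?_ ?_).symm
  · intro i hi
    have : i ∉ s := (Finset.mem_sdiff.1 hi).2
    simp [t', this]
  · intro i hi
    simp [t', hi]

lemma lintegral_interarrivalLaw (hr : 0 < r) {f : (ℕ → ℝ) → ℝ≥0∞} (hf : Measurable f) :
    ∫⁻ x, f x ∂interarrivalLaw r =
      ∫⁻ a, ∫⁻ x, f (consSeq a x) ∂interarrivalLaw r ∂expMeasure r := by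
  have := isProbabilityMeasure_expMeasure hr
  have := isProbabilityMeasure_interarrivalLaw hr
  conv_lhs => rw [← map_consSeq_interarrivalLaw hr]
  rw [lintegral_map hf (by fun_prop), lintegral_prod _ (by fun_prop)]

/-- A path of interarrival times with finitely many arrivals in bounded time. -/
structure IsRegularPath (x : ℕ → ℝ) : Prop where
  nonneg : ∀ n, 0 ≤ x n
  tendsto : Tendsto (arrivalTime x) atTop atTop

/-- By the second Borel-Cantelli lemma, infinitely many interarrival times exceed `1`. -/
lemma ae_isRegularPath (hr : 0 < r) : ∀ᵐ x ∂interarrivalLaw r, IsRegularPath x := by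
  have := isProbabilityMeasure_expMeasure hr
  have := isProbabilityMeasure_interarrivalLaw hr
  have hmap : ∀ n, MeasurePreserving (fun x : ℕ → ℝ => x n) (interarrivalLaw r) (expMeasure r) :=
    fun n => measurePreserving_eval_infinitePi (fun _ => expMeasure r) n
  have hnn : ∀ᵐ x ∂interarrivalLaw r, ∀ n, 0 ≤ x n := by
    rw [ae_all_iff]
    exact fun n => (hmap n).quasiMeasurePreserving.ae (ae_nonneg_expMeasure r)
  have hind : iIndepFun (fun (n : ℕ) (x : ℕ → ℝ) => x n) (interarrivalLaw r) :=
    iIndepFun_infinitePi (P := fun _ : ℕ => expMeasure r) (X := fun _ x => x)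
      fun _ => measurable_id
  have hset : iIndepSet (fun n : ℕ => {x : ℕ → ℝ | 1 ≤ x n}) (interarrivalLaw r) :=
    (iIndepSet_iff_meas_biInter fun n =>
      measurableSet_le measurable_const (measurable_pi_apply n)).2 fun s =>
        hind.measure_inter_preimage_eq_mul s (sets := fun _ => Set.Ici 1)
          fun _ _ => measurableSet_Ici
  have hmeas : ∀ n : ℕ, interarrivalLaw r {x | 1 ≤ x n} =
      ENNReal.ofReal (Real.exp (-(r * 1))) := fun n => by
    rw [← expMeasure_Ici hr zero_le_one]
    exact (hmap n).measure_preimage measurableSet_Ici.nullMeasurableSet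
  have hsum : ∑' n : ℕ, interarrivalLaw r {x | 1 ≤ x n} = ∞ := by
    simp_rw [hmeas]
    exact ENNReal.tsum_const_eq_top_of_ne_zero (by simp [Real.exp_pos])
  have hlim := measure_limsup_eq_one
    (fun n => measurableSet_le measurable_const (measurable_pi_apply n)) hset hsum
  have hfreq : ∀ᵐ x ∂interarrivalLaw r, ∃ᶠ n in atTop, 1 ≤ x n := by
    have h := (prob_compl_eq_zero_iff (MeasurableSet.measurableSet_limsup fun n =>
      measurableSet_le measurable_const (measurable_pi_apply n))).2 hlim
    filter_upwards [compl_mem_ae_iff.2 h] with x hx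
    rw [compl_compl, mem_limsup_iff_frequently_mem] at hx
    exact hx
  filter_upwards [hnn, hfreq] with x h0 hf
  refine ⟨h0, ?_⟩
  have hns : ¬ Summable x := fun hs => by
    have := hs.tendsto_atTop_zero.eventually (gt_mem_nhds zero_lt_one)
    exact hf (this.mono fun n hn => not_le.2 hn)
  exact ((not_summable_iff_tendsto_nat_atTop_of_nonneg h0).1 hns).comp (tendsto_add_atTop_nat 1)

end Law

/-! ### Restarting a path at its first arrival -/

lemma arrivalTime_succ (x : ℕ → ℝ) (n : ℕ) :
    arrivalTime x (n + 1) = x 0 + arrivalTime (fun k => x (k + 1)) n := by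
  simp only [arrivalTime]
  rw [Finset.sum_range_succ', add_comm]

lemma arrivalTime_consSeq_sub (x : ℕ → ℝ) (s : ℝ) (n : ℕ) :
    arrivalTime (consSeq (x 0 - s) fun k => x (k + 1)) n = arrivalTime x n - s := by
  simp only [arrivalTime]
  rw [Finset.sum_range_succ', Finset.sum_range_succ']
  simp only [consSeq_succ, consSeq_zero]
  ring

lemma arrivalCount_consSeq_sub (x : ℕ → ℝ) (s t : ℝ) :
    arrivalCount (consSeq (x 0 - s) fun k => x (k + 1)) t = arrivalCount x (s + t) := by
  simp only [arrivalCount, arrivalTime_consSeq_sub, sub_le_iff_le_add']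

lemma arrivalCountBefore_consSeq_sub (x : ℕ → ℝ) (s t : ℝ) :
    arrivalCountBefore (consSeq (x 0 - s) fun k => x (k + 1)) t =
      arrivalCountBefore x (s + t) := by
  simp only [arrivalCountBefore, arrivalTime_consSeq_sub, sub_lt_iff_lt_add']

namespace IsRegularPath

variable {x : ℕ → ℝ}

lemma tail (hx : IsRegularPath x) : IsRegularPath fun k => x (k + 1) where
  nonneg n := hx.nonneg _
  tendsto := by
    have h := tendsto_atTop_add_const_right _ (-x 0) (hx.tendsto.comp (tendsto_add_atTop_nat 1))
    refine h.congr fun n => ?_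
    simp [arrivalTime_succ]

lemma delay (hx : IsRegularPath x) {s : ℝ} (hs : s ≤ x 0) :
    IsRegularPath (consSeq (x 0 - s) fun k => x (k + 1)) where
  nonneg n := by
    cases n with
    | zero => simpa using hs
    | succ n => exact hx.nonneg _
  tendsto := by
    refine (tendsto_atTop_add_const_right _ (-s) hx.tendsto).congr fun n => ?_
    rw [arrivalTime_consSeq_sub, sub_eq_add_neg]

lemma le_arrivalTime (hx : IsRegularPath x) (n : ℕ) : x 0 ≤ arrivalTime x n := by
  refine Finset.single_le_sum (f := x) (fun i _ => hx.nonneg i) ?_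
  simp

lemma finite_arrivals (hx : IsRegularPath x) (t : ℝ) :
    {n : ℕ | arrivalTime x n ≤ t}.Finite := by
  obtain ⟨N, hN⟩ := (hx.tendsto.eventually_gt_atTop t).exists_forall_of_atTop
  refine (Set.finite_Iio N).subset fun n hn => ?_
  by_contra h
  exact absurd (hN n (not_lt.1 h)) (not_lt.2 hn)

lemma arrivalCount_eq_zero (hx : IsRegularPath x) {t : ℝ} (ht : t < x 0) :
    arrivalCount x t = 0 := by
  have : {n : ℕ | arrivalTime x n ≤ t} = ∅ :=
    Set.eq_empty_of_forall_notMem fun n hn => absurd (hx.le_arrivalTime n)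
      (not_le.2 (lt_of_le_of_lt hn ht))
  rw [arrivalCount, this, Set.ncard_empty]

lemma arrivalCountBefore_eq_zero (hx : IsRegularPath x) {t : ℝ} (ht : t ≤ x 0) :
    arrivalCountBefore x t = 0 := by
  have : {n : ℕ | arrivalTime x n < t} = ∅ :=
    Set.eq_empty_of_forall_notMem fun n hn => absurd (hx.le_arrivalTime n)
      (not_le.2 (lt_of_lt_of_le hn ht))
  rw [arrivalCountBefore, this, Set.ncard_empty]

lemma arrivalCount_add (hx : IsRegularPath x) {t : ℝ} (ht : 0 ≤ t) :
    arrivalCount x (x 0 + t) = arrivalCount (fun k => x (k + 1)) t + 1 := by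
  have : {n : ℕ | arrivalTime x n ≤ x 0 + t} =
      insert 0 (Nat.succ '' {n : ℕ | arrivalTime (fun k => x (k + 1)) n ≤ t}) := by
    ext n
    cases n with
    | zero => simp [arrivalTime, ht]
    | succ n => simp [arrivalTime_succ]
  rw [arrivalCount, this, Set.ncard_insert_of_notMem (by simp)
    ((hx.tail.finite_arrivals t).image _), Set.ncard_image_of_injective _ Nat.succ_injective,
    arrivalCount]

lemma arrivalCountBefore_add (hx : IsRegularPath x) {t : ℝ} (ht : 0 < t) :
    arrivalCountBefore x (x 0 + t) = arrivalCountBefore (fun k => x (k + 1)) t + 1 := by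
  have : {n : ℕ | arrivalTime x n < x 0 + t} =
      insert 0 (Nat.succ '' {n : ℕ | arrivalTime (fun k => x (k + 1)) n < t}) := by
    ext n
    cases n with
    | zero => simp [arrivalTime, ht]
    | succ n => simp [arrivalTime_succ]
  have hf : {n : ℕ | arrivalTime (fun k => x (k + 1)) n < t}.Finite :=
    (hx.tail.finite_arrivals t).subset fun n hn => (show _ < t from hn).le
  rw [arrivalCountBefore, this, Set.ncard_insert_of_notMem (by simp)
    (hf.image _), Set.ncard_image_of_injective _ Nat.succ_injective, arrivalCountBefore]

end IsRegularPath

/-- The buffer size right after the first arrival, from the initial size `q`. The free server has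
the first arrival when `x 0 < y 0`; otherwise the costly server has it, and its packet is
received according to the policy. -/
def nextLevel (u : ℝ → ℕ) (q : ℝ) (x y : ℕ → ℝ) : ℝ :=
  if x 0 < y 0 then q - x 0 + 1 else q - y 0 + u (q - y 0)

/-- The interarrival times of the first of the two servers as seen from the first arrival of
either. -/
def nextFree (x y : ℕ → ℝ) : ℕ → ℝ :=
  if x 0 < y 0 then fun k => x (k + 1) else consSeq (x 0 - y 0) fun k => x (k + 1)

/-- The interarrival times of the second of the two servers as seen from the first arrival of
either. -/
def nextCostly (x y : ℕ → ℝ) : ℕ → ℝ :=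
  if x 0 < y 0 then consSeq (y 0 - x 0) fun k => y (k + 1) else fun k => y (k + 1)

section Restart

variable {u : ℝ → ℕ} {q : ℝ} {x y : ℕ → ℝ}

lemma IsRegularPath.nextFree (hx : IsRegularPath x) : IsRegularPath (nextFree x y) := by
  unfold _root_.nextFree
  split_ifs with h
  · exact hx.tail
  · exact hx.delay (not_lt.1 h)

lemma IsRegularPath.nextCostly (hy : IsRegularPath y) : IsRegularPath (nextCostly x y) := by
  unfold _root_.nextCostly
  split_ifs with h
  · exact hy.delay h.le
  · exact hy.tail

lemma bufferSize_before (hx : IsRegularPath x) (hy : IsRegularPath y) {t : ℝ}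
    (ht : t < min (x 0) (y 0)) : bufferSize u q x y t = q - t := by
  rw [bufferSize, hx.arrivalCount_eq_zero (lt_of_lt_of_le ht (min_le_left _ _)),
    hy.arrivalCount_eq_zero (lt_of_lt_of_le ht (min_le_right _ _))]
  simp [costlyReceived]

lemma costlyReceived_free_first (hx : IsRegularPath x) (hy : IsRegularPath y)
    (h : x 0 < y 0) (n : ℕ) :
    costlyReceived u (q - x 0 + 1) (fun k => x (k + 1)) (consSeq (y 0 - x 0) fun k => y (k + 1)) n =
      costlyReceived u q x y n := by
  induction n with
  | zero => rfl
  | succ n ih =>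
    have hpos : 0 < arrivalTime y n - x 0 := by linarith [hy.le_arrivalTime n]
    have hb := hx.arrivalCountBefore_add hpos
    rw [add_sub_cancel] at hb
    simp only [costlyReceived]
    rw [ih, arrivalTime_consSeq_sub, hb]
    congr 2
    push_cast
    ring

lemma costlyReceived_costly_first (hx : IsRegularPath x) (h : y 0 ≤ x 0) (n : ℕ) :
    costlyReceived u q x y (n + 1) = u (q - y 0) +
      costlyReceived u (q - y 0 + u (q - y 0)) (consSeq (x 0 - y 0) fun k => x (k + 1))
        (fun k => y (k + 1)) n := by
  induction n with
  | zero => simp [costlyReceived, arrivalTime, hx.arrivalCountBefore_eq_zero h]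
  | succ n ih =>
    rw [costlyReceived, ih, costlyReceived, arrivalCountBefore_consSeq_sub, arrivalTime_succ,
      add_assoc]
    congr 3
    push_cast
    ring

lemma bufferSize_after (hx : IsRegularPath x) (hy : IsRegularPath y) {t : ℝ} (ht : 0 ≤ t) :
    bufferSize u q x y (min (x 0) (y 0) + t) =
      bufferSize u (nextLevel u q x y) (nextFree x y) (nextCostly x y) t := by
  unfold nextLevel nextFree nextCostly
  by_cases h : x 0 < y 0
  · simp only [if_pos h, min_eq_left h.le]
    rw [bufferSize, bufferSize, hx.arrivalCount_add ht, arrivalCount_consSeq_sub,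
      costlyReceived_free_first hx hy h]
    push_cast
    ring
  · simp only [if_neg h, min_eq_right (not_lt.1 h)]
    rw [bufferSize, bufferSize, hy.arrivalCount_add ht, arrivalCount_consSeq_sub,
      costlyReceived_costly_first hx (not_lt.1 h)]
    push_cast
    ring

lemma arrivalCount_after (hx : IsRegularPath x) (hy : IsRegularPath y) {t : ℝ} (ht : 0 ≤ t) :
    arrivalCount x (min (x 0) (y 0) + t) + arrivalCount y (min (x 0) (y 0) + t) =
      arrivalCount (nextFree x y) t + arrivalCount (nextCostly x y) t + 1 := by
  unfold nextFree nextCostly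
  by_cases h : x 0 < y 0
  · simp only [if_pos h, min_eq_left h.le]
    rw [hx.arrivalCount_add ht, arrivalCount_consSeq_sub]
    ring
  · simp only [if_neg h, min_eq_right (not_lt.1 h)]
    rw [hy.arrivalCount_add ht, arrivalCount_consSeq_sub]
    ring

end Restart

/-! ### The cost of a path, arrival by arrival -/

/-- The cost of the path started from `q` up to its arrival number `n`, or up to the interruption
if this comes first: the running cost `c` is paid at unit rate as a function of the buffer size,
and the amount `b` is paid at the interruption. -/
def truncCost (c : ℝ → ℝ≥0∞) (b : ℝ≥0∞) (u : ℝ → ℕ) : ℕ → ℝ → (ℕ → ℝ) → (ℕ → ℝ) → ℝ≥0∞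
  | 0, _, _, _ => 0
  | n + 1, q, x, y =>
    (∫⁻ r in Set.Ici 0, if r < min (x 0) (y 0) ∧ r < q then c (q - r) else 0) +
      if min (x 0) (y 0) ≤ q then
        truncCost c b u n (nextLevel u q x y) (nextFree x y) (nextCostly x y)
      else b

/-- The times up to `t` at which a path `Q` has not been interrupted. -/
def aliveUntil (Q : ℝ → ℝ) (t : ℝ) : Set ℝ :=
  {r | 0 ≤ r ∧ r ≤ t ∧ ∀ r', 0 ≤ r' → r' ≤ r → Q r' ≠ 0}

lemma measurableSet_aliveUntil (Q : ℝ → ℝ) (t : ℝ) : MeasurableSet (aliveUntil Q t) := by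
  refine Set.OrdConnected.measurableSet ⟨fun r hr r' hr' z hz => ?_⟩
  exact ⟨hr.1.trans hz.1, hz.2.trans hr'.2.1, fun w h0 hw => hr'.2.2 w h0 (hw.trans hz.2)⟩

section PathCost

variable {c : ℝ → ℝ≥0∞} {b : ℝ≥0∞} {u : ℝ → ℕ}

lemma truncCost_le_succ (n : ℕ) (q : ℝ) (x y : ℕ → ℝ) :
    truncCost c b u n q x y ≤ truncCost c b u (n + 1) q x y := by
  induction n generalizing q x y with
  | zero => exact zero_le
  | succ n ih =>
    rw [truncCost, truncCost]
    gcongr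
    split_ifs
    · exact ih _ _ _
    · exact le_rfl

open scoped Classical in
/-- A path with at most `n - 1` arrivals up to time `t` costs up to time `t` at most as much as up
to its arrival number `n`. -/
lemma cost_le_truncCost (hc : Measurable c) (n : ℕ) {t q : ℝ} {x y : ℕ → ℝ}
    (hx : IsRegularPath x) (hy : IsRegularPath y) (hq : 0 ≤ q)
    (hn : arrivalCount x t + arrivalCount y t < n) :
    (∫⁻ r in aliveUntil (bufferSize u q x y) t, c (bufferSize u q x y r)) +
      (if ∃ r, 0 ≤ r ∧ r ≤ t ∧ bufferSize u q x y r = 0 then b else 0) ≤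
        truncCost c b u n q x y := by
  induction n generalizing t q x y with
  | zero => exact absurd hn (by omega)
  | succ n ih =>
    set s := min (x 0) (y 0) with hs
    have hs0 : 0 ≤ s := le_min (hx.nonneg 0) (hy.nonneg 0)
    have hbefore : ∀ r, r < s → bufferSize u q x y r = q - r := fun r hr =>
      bufferSize_before hx hy hr
    set f : ℝ → ℝ≥0∞ :=
      (Set.Ici 0).indicator fun r => if r < s ∧ r < q then c (q - r) else 0 with hf
    have hfm : Measurable f := by
      refine Measurable.indicator ?_ measurableSet_Ici
      exact Measurable.ite (measurableSet_Iio.inter measurableSet_Iio)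
        (hc.comp (measurable_const.sub measurable_id)) measurable_const
    have hfi : ∫⁻ r, f r =
        ∫⁻ r in Set.Ici 0, if r < s ∧ r < q then c (q - r) else 0 :=
      lintegral_indicator measurableSet_Ici _
    have hfirst : ∀ r ∈ aliveUntil (bufferSize u q x y) t, r < s →
        c (bufferSize u q x y r) ≤ f r := fun r hr hrs => by
      -- Before the first arrival the buffer decreases at unit rate, so it empties at time `q`.
      have hrq : r < q := by
        by_contra hle
        refine hr.2.2 q hq (not_lt.1 hle) ?_
        rw [hbefore q (lt_of_le_of_lt (not_lt.1 hle) hrs), sub_self]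
      rw [hbefore r hrs, hf, Set.indicator_of_mem (show r ∈ Set.Ici (0 : ℝ) from hr.1),
        if_pos ⟨hrs, hrq⟩]
    rw [truncCost, ← hs, ← hfi, ← lintegral_indicator (measurableSet_aliveUntil _ _)]
    by_cases hst : s ≤ t ∧ s ≤ q
    · obtain ⟨hst, hsq⟩ := hst
      rw [if_pos hsq]
      have hafter : ∀ r, s ≤ r → bufferSize u q x y r =
          bufferSize u (nextLevel u q x y) (nextFree x y) (nextCostly x y) (r - s) := fun r hr => by
        rw [← bufferSize_after hx hy (sub_nonneg.2 hr), ← hs, add_sub_cancel]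
      have hq' : 0 ≤ nextLevel u q x y := by
        unfold nextLevel
        split_ifs with h
        · rw [min_eq_left h.le] at hs
          linarith
        · rw [min_eq_right (not_lt.1 h)] at hs
          have : (0 : ℝ) ≤ u (q - y 0) := Nat.cast_nonneg _
          linarith
      have hcount := arrivalCount_after hx hy (sub_nonneg.2 hst)
      rw [← hs, add_sub_cancel] at hcount
      have hrec := ih (t := t - s) (hx.nextFree (y := y)) (hy.nextCostly (x := x)) hq' (by omega)
      set Q' := bufferSize u (nextLevel u q x y) (nextFree x y) (nextCostly x y) with hQ'
      rw [← lintegral_indicator (measurableSet_aliveUntil _ _),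
        ← lintegral_sub_right_eq_self _ s] at hrec
      refine le_trans ?_ (add_le_add_right hrec (∫⁻ r, f r))
      rw [← add_assoc, ← lintegral_add_left hfm]
      gcongr with r
      · by_cases hr : r ∈ aliveUntil (bufferSize u q x y) t
        · rw [Set.indicator_of_mem hr]
          by_cases hrs : r < s
          · exact (hfirst r hr hrs).trans le_self_add
          · have hr' : r - s ∈ aliveUntil Q' (t - s) := by
              refine ⟨sub_nonneg.2 (not_lt.1 hrs), by linarith [hr.2.1], fun z hz hzr => ?_⟩
              have := hr.2.2 (s + z) (by linarith) (by linarith)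
              rwa [hafter _ (by linarith), add_sub_cancel_left] at this
            rw [Set.indicator_of_mem hr', hafter r (not_lt.1 hrs)]
            exact le_add_self
        · rw [Set.indicator_of_notMem hr]
          exact zero_le
      · split_ifs with h1 h2 h2
        · exact le_rfl
        · obtain ⟨r, hr0, hrt, hr⟩ := h1
          refine absurd ?_ h2
          rcases lt_or_ge r s with hrs | hrs
          · rw [hbefore r hrs] at hr
            linarith
          · exact ⟨r - s, by linarith, by linarith, by rw [← hr, hafter r hrs]⟩
        · exact zero_le
        · exact le_rfl
    · gcongr ?_ + ?_
      · refine lintegral_mono fun r => ?_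
        by_cases hr : r ∈ aliveUntil (bufferSize u q x y) t
        · rw [Set.indicator_of_mem hr]
          refine hfirst r hr ?_
          by_contra hrs
          have hsq : ¬ s ≤ q := fun h => hst ⟨(not_lt.1 hrs).trans hr.2.1, h⟩
          refine hr.2.2 q hq (by linarith [not_le.1 hsq, not_lt.1 hrs]) ?_
          rw [hbefore q (not_le.1 hsq), sub_self]
        · rw [Set.indicator_of_notMem hr]
          exact zero_le
      · by_cases hsq : s ≤ q
        · have hts : t < s := not_le.1 fun h => hst ⟨h, hsq⟩
          rw [if_neg]
          · exact zero_le
          · rintro ⟨r, -, hrt, hr⟩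
            rw [hbefore r (by linarith)] at hr
            linarith
        · rw [if_neg hsq]
          split_ifs
          · exact le_rfl
          · exact zero_le

open scoped Classical in
/-- Since arrivals do not accumulate, the total cost of a path is the limit of its costs up to its
arrival number `n`. -/
lemma cost_le_iSup_truncCost (hc : Measurable c) {q : ℝ} {x y : ℕ → ℝ}
    (hx : IsRegularPath x) (hy : IsRegularPath y) (hq : 0 ≤ q) :
    (∫⁻ t in {t : ℝ | 0 ≤ t ∧ (t : EReal) < interruptionTime (bufferSize u q x y)},
        c (bufferSize u q x y t)) +
      (if interruptionTime (bufferSize u q x y) < ⊤ then b else 0) ≤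
        ⨆ n, truncCost c b u n q x y := by
  set Q := bufferSize u q x y with hQ
  have hcost : ∀ t, (∫⁻ r in aliveUntil Q t, c (Q r)) +
      (if ∃ r, 0 ≤ r ∧ r ≤ t ∧ Q r = 0 then b else 0) ≤ ⨆ n, truncCost c b u n q x y := fun t =>
    (cost_le_truncCost hc (arrivalCount x t + arrivalCount y t + 1) hx hy hq
      (Nat.lt_succ_self _)).trans (le_iSup (fun n => truncCost c b u n q x y) _)
  have hmono : Monotone (aliveUntil Q) := fun s t hst r hr => ⟨hr.1, hr.2.1.trans hst, hr.2.2⟩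
  have hsub : {t : ℝ | 0 ≤ t ∧ (t : EReal) < interruptionTime Q} ⊆ ⋃ k : ℕ, aliveUntil Q k := by
    rintro t ⟨ht0, ht⟩
    obtain ⟨k, hk⟩ := exists_nat_ge t
    refine Set.mem_iUnion.2 ⟨k, ht0, hk, fun r hr hrt h0 => ?_⟩
    have h1 : interruptionTime Q ≤ (r : EReal) := sInf_le ⟨r, ⟨hr, h0⟩, rfl⟩
    exact absurd (lt_of_lt_of_le ht h1) (not_lt.2 (EReal.coe_le_coe_iff.2 hrt))
  refine (add_le_add_left (lintegral_mono_set hsub) _).trans ?_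
  rw [setLIntegral_iUnion_of_directed _
    (Monotone.directed_le fun i j hij => hmono (Nat.cast_le.2 hij)), ENNReal.iSup_add]
  refine iSup_le fun k => ?_
  split_ifs with h
  · obtain ⟨-, ⟨r, ⟨hr0, hr⟩, rfl⟩, -⟩ := sInf_lt_iff.1 h
    refine le_trans ?_ (hcost (max k r))
    rw [if_pos ⟨r, hr0, le_max_right _ _, hr⟩]
    gcongr
    exact hmono (le_max_left _ _)
  · exact (add_le_add_right zero_le _).trans (hcost k)

end PathCost

/-! ### Mean costs and the renewal inequality -/

section Mean

variable {c : ℝ → ℝ≥0∞} {b : ℝ≥0∞} {u : ℝ → ℕ} {r s : ℝ}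

lemma measurable_truncCost (hc : Measurable c) (hu : Measurable u) (n : ℕ) :
    Measurable fun p : ℝ × (ℕ → ℝ) × (ℕ → ℝ) => truncCost c b u n p.1 p.2.1 p.2.2 := by
  induction n with
  | zero => exact measurable_const
  | succ n ih =>
    have hx : ∀ k, Measurable fun p : ℝ × (ℕ → ℝ) × (ℕ → ℝ) => p.2.1 k := fun k =>
      (measurable_pi_apply k).comp measurable_snd.fst
    have hy : ∀ k, Measurable fun p : ℝ × (ℕ → ℝ) × (ℕ → ℝ) => p.2.2 k := fun k =>
      (measurable_pi_apply k).comp measurable_snd.snd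
    have htx : Measurable fun (p : ℝ × (ℕ → ℝ) × (ℕ → ℝ)) k => p.2.1 (k + 1) :=
      measurable_pi_lambda _ fun k => hx (k + 1)
    have hty : Measurable fun (p : ℝ × (ℕ → ℝ) × (ℕ → ℝ)) k => p.2.2 (k + 1) :=
      measurable_pi_lambda _ fun k => hy (k + 1)
    have hlt : MeasurableSet {p : ℝ × (ℕ → ℝ) × (ℕ → ℝ) | p.2.1 0 < p.2.2 0} :=
      measurableSet_lt (hx 0) (hy 0)
    have hcu : Measurable fun p : ℝ × (ℕ → ℝ) × (ℕ → ℝ) => (u (p.1 - p.2.2 0) : ℝ) :=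
      measurable_from_nat.comp (hu.comp (measurable_fst.sub (hy 0)))
    have hlevel : Measurable fun p : ℝ × (ℕ → ℝ) × (ℕ → ℝ) => nextLevel u p.1 p.2.1 p.2.2 :=
      Measurable.ite hlt ((measurable_fst.sub (hx 0)).add_const 1)
        ((measurable_fst.sub (hy 0)).add hcu)
    have hfree : Measurable fun p : ℝ × (ℕ → ℝ) × (ℕ → ℝ) => nextFree p.2.1 p.2.2 :=
      Measurable.ite hlt htx (Measurable.consSeq ((hx 0).sub (hy 0)) htx)
    have hcostly : Measurable fun p : ℝ × (ℕ → ℝ) × (ℕ → ℝ) => nextCostly p.2.1 p.2.2 :=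
      Measurable.ite hlt (Measurable.consSeq ((hy 0).sub (hx 0)) hty) hty
    simp only [truncCost]
    refine Measurable.add ?_ (Measurable.ite (measurableSet_le ((hx 0).min (hy 0)) measurable_fst)
      (ih.comp (hlevel.prodMk (hfree.prodMk hcostly))) measurable_const)
    refine Measurable.lintegral_prod_right' (f := fun z : (ℝ × (ℕ → ℝ) × (ℕ → ℝ)) × ℝ =>
      if z.2 < min (z.1.2.1 0) (z.1.2.2 0) ∧ z.2 < z.1.1 then c (z.1.1 - z.2) else 0) ?_
    refine Measurable.ite (MeasurableSet.inter ?_ ?_)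
      (hc.comp (measurable_fst.fst.sub measurable_snd)) measurable_const
    · exact measurableSet_lt measurable_snd
        (((hx 0).comp measurable_fst).min ((hy 0).comp measurable_fst))
    · exact measurableSet_lt measurable_snd measurable_fst.fst

/-- The mean cost up to arrival number `n`, from the initial buffer size `q`, when the free and
the costly server have rates `r` and `s`. -/
def meanTruncCost (r s : ℝ) (c : ℝ → ℝ≥0∞) (b : ℝ≥0∞) (u : ℝ → ℕ) (n : ℕ) (q : ℝ) : ℝ≥0∞ :=
  ∫⁻ p, truncCost c b u n q p.1 p.2 ∂((interarrivalLaw r).prod (interarrivalLaw s))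

/-- When the clock of rate `r` rings first, at time `a`, the clock of rate `s` starts afresh at
that time, by memorylessness. -/
lemma lintegral_restart (hr : 0 < r) (hs : 0 < s) {K : ℝ → (ℕ → ℝ) → (ℕ → ℝ) → ℝ≥0∞}
    (hK : Measurable fun p : ℝ × (ℕ → ℝ) × (ℕ → ℝ) => K p.1 p.2.1 p.2.2) :
    ∫⁻ p, ∫⁻ z, (Set.Ici p.1).indicator (fun e => K p.1 p.2 (consSeq (e - p.1) z.2)) z.1
        ∂((expMeasure s).prod (interarrivalLaw s)) ∂((expMeasure r).prod (interarrivalLaw r)) =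
      ∫⁻ a in Set.Ici 0, ENNReal.ofReal (r * Real.exp (-((r + s) * a))) *
        ∫⁻ z, K a z.1 z.2 ∂((interarrivalLaw r).prod (interarrivalLaw s)) := by
  have := isProbabilityMeasure_expMeasure hr
  have := isProbabilityMeasure_interarrivalLaw hr
  have := isProbabilityMeasure_expMeasure hs
  have := isProbabilityMeasure_interarrivalLaw hs
  have hinner : ∀ a, 0 ≤ a → ∀ ξ : ℕ → ℝ,
      ∫⁻ z, (Set.Ici a).indicator (fun e => K a ξ (consSeq (e - a) z.2)) z.1
        ∂((expMeasure s).prod (interarrivalLaw s)) =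
      ENNReal.ofReal (Real.exp (-(s * a))) * ∫⁻ y, K a ξ y ∂interarrivalLaw s := by
    intro a ha ξ
    have hKa : Measurable (K a ξ) := hK.comp (measurable_const.prodMk
      (measurable_const.prodMk measurable_id))
    have hKc : Measurable fun z : ℝ × (ℕ → ℝ) => K a ξ (consSeq z.1 z.2) :=
      hKa.comp (Measurable.consSeq measurable_fst measurable_snd)
    have hm : Measurable fun z : ℝ × (ℕ → ℝ) =>
        (Set.Ici a).indicator (fun e => K a ξ (consSeq (e - a) z.2)) z.1 :=
      Measurable.ite (measurable_fst measurableSet_Ici)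
        (hKc.comp ((measurable_fst.sub_const a).prodMk measurable_snd)) measurable_const
    rw [lintegral_prod _ hm.aemeasurable, lintegral_interarrivalLaw hs hKa,
      ← lintegral_expMeasure_Ici ha hKc.lintegral_prod_right']
    refine lintegral_congr fun e => ?_
    by_cases he : e ∈ Set.Ici a
    · simp only [Set.indicator_of_mem he]
    · simp only [Set.indicator_of_notMem he, lintegral_zero]
  have hKm : Measurable fun p : ℝ × (ℕ → ℝ) => ∫⁻ y, K p.1 p.2 y ∂interarrivalLaw s :=
    Measurable.lintegral_prod_right' (f := fun z : (ℝ × (ℕ → ℝ)) × (ℕ → ℝ) => K z.1.1 z.1.2 z.2)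
      (hK.comp (measurable_fst.fst.prodMk (measurable_fst.snd.prodMk measurable_snd)))
  have hae : ∀ᵐ p ∂((expMeasure r).prod (interarrivalLaw r)), 0 ≤ p.1 :=
    Measure.quasiMeasurePreserving_fst.ae (ae_nonneg_expMeasure r)
  rw [lintegral_congr_ae (hae.mono fun p hp => hinner p.1 hp p.2),
    lintegral_prod _ (Measurable.aemeasurable (by fun_prop))]
  have hKm' : ∀ a, Measurable fun ξ : ℕ → ℝ => ∫⁻ y, K a ξ y ∂interarrivalLaw s := fun a =>
    hKm.comp (measurable_const.prodMk measurable_id)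
  simp only
  simp_rw [lintegral_const_mul _ (hKm' _)]
  have hKm₂ : Measurable fun a => ENNReal.ofReal (Real.exp (-(s * a))) *
      ∫⁻ ξ, ∫⁻ y, K a ξ y ∂interarrivalLaw s ∂interarrivalLaw r :=
    Measurable.mul (by fun_prop) hKm.lintegral_prod_right'
  rw [lintegral_expMeasure r hKm₂]
  refine lintegral_congr fun a => ?_
  have hKa : Measurable fun z : (ℕ → ℝ) × (ℕ → ℝ) => K a z.1 z.2 :=
    hK.comp (measurable_const.prodMk measurable_id)
  rw [lintegral_prod _ hKa.aemeasurable, ← mul_assoc,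
    ← ENNReal.ofReal_mul' (Real.exp_pos _).le, mul_assoc, ← Real.exp_add]
  ring_nf

lemma lintegral_interarrivalLaw_prod (hr : 0 < r) (hs : 0 < s)
    {f : (ℕ → ℝ) × (ℕ → ℝ) → ℝ≥0∞} (hf : Measurable f) :
    ∫⁻ p, f p ∂((interarrivalLaw r).prod (interarrivalLaw s)) =
      ∫⁻ p, ∫⁻ z, f (consSeq p.1 p.2, consSeq z.1 z.2)
        ∂((expMeasure s).prod (interarrivalLaw s))
        ∂((expMeasure r).prod (interarrivalLaw r)) := by
  have := isProbabilityMeasure_expMeasure hr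
  have := isProbabilityMeasure_interarrivalLaw hr
  have := isProbabilityMeasure_expMeasure hs
  have := isProbabilityMeasure_interarrivalLaw hs
  have hm : Measurable fun p : ℝ × (ℕ → ℝ) => consSeq p.1 p.2 := by fun_prop
  conv_lhs => rw [← map_consSeq_interarrivalLaw hr, ← map_consSeq_interarrivalLaw hs]
  rw [Measure.map_prod_map _ _ hm hm, lintegral_map hf (hm.prodMap hm),
    lintegral_prod (fun p => f (Prod.map _ _ p)) (hf.comp (hm.prodMap hm)).aemeasurable]
  rfl

/-- First-step decomposition of the cost: the running cost before the first arrival, the cost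
after a first arrival from the free or from the costly server, and the cost of an interruption
before the first arrival. Ties are counted twice, hence the inequality. -/
lemma truncCost_succ_le (n : ℕ) (q a e : ℝ) (ξ η : ℕ → ℝ) :
    truncCost c b u (n + 1) q (consSeq a ξ) (consSeq e η) ≤
      (∫⁻ t in Set.Icc 0 q, (c (q - t) * (Set.Ici t).indicator 1 a * (Set.Ici t).indicator 1 e)) +
      (Set.Ici a).indicator (fun e' =>
        if a ≤ q then truncCost c b u n (q - a + 1) ξ (consSeq (e' - a) η) else 0) e +
      (Set.Ici e).indicator (fun a' =>
        if e ≤ q then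
          truncCost c b u n (q - e + u (q - e)) (consSeq (a' - e) ξ) η else 0) a +
      b * (Set.Ici q).indicator 1 a * (Set.Ici q).indicator 1 e := by
  have hstep : truncCost c b u (n + 1) q (consSeq a ξ) (consSeq e η) =
      (∫⁻ t in Set.Ici 0, if t < min a e ∧ t < q then c (q - t) else 0) +
        if min a e ≤ q then truncCost c b u n (nextLevel u q (consSeq a ξ) (consSeq e η))
          (nextFree (consSeq a ξ) (consSeq e η)) (nextCostly (consSeq a ξ) (consSeq e η))
        else b := rfl
  rw [hstep, add_assoc, add_assoc]
  gcongr ?_ + ?_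
  · rw [← lintegral_indicator measurableSet_Ici, ← lintegral_indicator measurableSet_Icc]
    refine lintegral_mono fun t => ?_
    by_cases ht : 0 ≤ t
    · rw [Set.indicator_of_mem (Set.mem_Ici.2 ht)]
      by_cases h : t < min a e ∧ t < q
      · rw [if_pos h, Set.indicator_of_mem (Set.mem_Icc.2 ⟨ht, h.2.le⟩),
          Set.indicator_of_mem (Set.mem_Ici.2 (lt_min_iff.1 h.1).1.le),
          Set.indicator_of_mem (Set.mem_Ici.2 (lt_min_iff.1 h.1).2.le)]
        simp
      · rw [if_neg h]
        exact zero_le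
    · rw [Set.indicator_of_notMem (by simpa using ht)]
      exact zero_le
  · by_cases h : min a e ≤ q
    · rw [if_pos h]
      by_cases hae : a < e
      · rw [min_eq_left hae.le] at h
        refine le_trans (le_of_eq ?_) le_self_add
        rw [Set.indicator_of_mem (Set.mem_Ici.2 hae.le), if_pos h]
        simp [nextLevel, nextFree, nextCostly, hae]
      · rw [min_eq_right (not_lt.1 hae)] at h
        refine le_trans (le_trans (le_of_eq ?_) le_self_add) le_add_self
        rw [Set.indicator_of_mem (Set.mem_Ici.2 (not_lt.1 hae)), if_pos h]
        simp [nextLevel, nextFree, nextCostly, hae]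
    · rw [if_neg h]
      have h' := lt_min_iff.1 (not_le.1 h)
      refine le_trans (le_trans (le_of_eq ?_) le_add_self) le_add_self
      rw [Set.indicator_of_mem (Set.mem_Ici.2 h'.1.le), Set.indicator_of_mem
        (Set.mem_Ici.2 h'.2.le)]
      simp

lemma lintegral_Ici_fst (hr : 0 < r) {t : ℝ} (ht : 0 ≤ t) :
    ∫⁻ p, (Set.Ici t).indicator 1 p.1 ∂((expMeasure r).prod (interarrivalLaw r)) =
      ENNReal.ofReal (Real.exp (-(r * t))) := by
  have := isProbabilityMeasure_expMeasure hr
  have := isProbabilityMeasure_interarrivalLaw hr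
  have hm : Measurable fun p : ℝ × (ℕ → ℝ) => (Set.Ici t).indicator (1 : ℝ → ℝ≥0∞) p.1 :=
    (measurable_one.indicator measurableSet_Ici).comp measurable_fst
  rw [lintegral_prod _ hm.aemeasurable]
  simp only [lintegral_const, measure_univ, mul_one]
  rw [lintegral_indicator_one measurableSet_Ici, expMeasure_Ici hr ht]

lemma lintegral_lintegral_le_add {γ δ : Type*} [MeasurableSpace γ] [MeasurableSpace δ]
    {κ : Measure γ} {ν : Measure δ} [SFinite ν] {F : γ → δ → ℝ≥0∞} (f₁ f₂ f₃ f₄ : γ × δ → ℝ≥0∞)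
    (hF : ∀ p z, F p z ≤ f₁ (p, z) + f₂ (p, z) + f₃ (p, z) + f₄ (p, z))
    (hf₂ : Measurable f₂) (hf₃ : Measurable f₃) (hf₄ : Measurable f₄) :
    ∫⁻ p, ∫⁻ z, F p z ∂ν ∂κ ≤ ∫⁻ p, ∫⁻ z, f₁ (p, z) ∂ν ∂κ + ∫⁻ p, ∫⁻ z, f₂ (p, z) ∂ν ∂κ +
      ∫⁻ p, ∫⁻ z, f₃ (p, z) ∂ν ∂κ + ∫⁻ p, ∫⁻ z, f₄ (p, z) ∂ν ∂κ := by
  have hadd : ∀ f g : γ × δ → ℝ≥0∞, Measurable g → ∫⁻ p, ∫⁻ z, (f (p, z) + g (p, z)) ∂ν ∂κ =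
      ∫⁻ p, ∫⁻ z, f (p, z) ∂ν ∂κ + ∫⁻ p, ∫⁻ z, g (p, z) ∂ν ∂κ := fun f g hg => by
    rw [← lintegral_add_right _ hg.lintegral_prod_right']
    exact lintegral_congr fun p => lintegral_add_right _ (hg.comp measurable_prodMk_left)
  rw [← hadd f₁ f₂ hf₂, ← hadd (fun w => f₁ w + f₂ w) f₃ hf₃,
    ← hadd (fun w => f₁ w + f₂ w + f₃ w) f₄ hf₄]
  exact lintegral_mono fun p => lintegral_mono fun z => hF p z

/-- No arrival before time `t` has probability `exp (-(r + s) t)`. -/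
lemma lintegral_Ici_fst_mul_Ici_fst (b : ℝ≥0∞) (hr : 0 < r) (hs : 0 < s) {t : ℝ} (ht : 0 ≤ t) :
    ∫⁻ p, ∫⁻ z, b * (Set.Ici t).indicator 1 p.1 * (Set.Ici t).indicator 1 z.1
        ∂((expMeasure s).prod (interarrivalLaw s)) ∂((expMeasure r).prod (interarrivalLaw r)) =
      b * ENNReal.ofReal (Real.exp (-((r + s) * t))) := by
  have hI : Measurable fun p : ℝ × (ℕ → ℝ) => (Set.Ici t).indicator (1 : ℝ → ℝ≥0∞) p.1 :=
    (measurable_one.indicator measurableSet_Ici).comp measurable_fst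
  have h : ∀ p : ℝ × (ℕ → ℝ), ∫⁻ z, b * (Set.Ici t).indicator 1 p.1 * (Set.Ici t).indicator 1 z.1
      ∂((expMeasure s).prod (interarrivalLaw s)) =
      b * ENNReal.ofReal (Real.exp (-(s * t))) * (Set.Ici t).indicator 1 p.1 := fun p => by
    rw [lintegral_const_mul _ hI, lintegral_Ici_fst hs ht, mul_right_comm]
  rw [lintegral_congr h, lintegral_const_mul _ hI, lintegral_Ici_fst hr ht, mul_assoc,
    ← ENNReal.ofReal_mul (Real.exp_pos _).le, ← Real.exp_add]
  ring_nf

/-- The running cost before the first arrival. -/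
lemma lintegral_cost_before_arrival (hc : Measurable c) (hr : 0 < r) (hs : 0 < s) (q : ℝ) :
    ∫⁻ p, ∫⁻ z, (∫⁻ t in Set.Icc 0 q,
      (c (q - t) * (Set.Ici t).indicator 1 p.1 * (Set.Ici t).indicator 1 z.1))
        ∂((expMeasure s).prod (interarrivalLaw s)) ∂((expMeasure r).prod (interarrivalLaw r)) =
      ∫⁻ t in Set.Icc 0 q, ENNReal.ofReal (Real.exp (-((r + s) * t))) * c (q - t) := by
  have := isProbabilityMeasure_expMeasure hr
  have := isProbabilityMeasure_interarrivalLaw hr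
  have := isProbabilityMeasure_expMeasure hs
  have := isProbabilityMeasure_interarrivalLaw hs
  have hg : Measurable fun w : ((ℝ × (ℕ → ℝ)) × (ℝ × (ℕ → ℝ))) × ℝ =>
      c (q - w.2) * (Set.Ici w.2).indicator 1 w.1.1.1 * (Set.Ici w.2).indicator 1 w.1.2.1 :=
    ((hc.comp (measurable_const.sub measurable_snd)).mul
      (Measurable.ite (measurableSet_le measurable_snd measurable_fst.fst.fst)
        measurable_const measurable_const)).mul
      (Measurable.ite (measurableSet_le measurable_snd measurable_fst.snd.fst)
        measurable_const measurable_const)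
  rw [← lintegral_prod _ hg.lintegral_prod_right'.aemeasurable,
    lintegral_lintegral_swap hg.aemeasurable]
  refine setLIntegral_congr_fun measurableSet_Icc fun t ht => ?_
  have hgt : Measurable fun w : (ℝ × (ℕ → ℝ)) × (ℝ × (ℕ → ℝ)) =>
      c (q - t) * (Set.Ici t).indicator 1 w.1.1 * (Set.Ici t).indicator 1 w.2.1 :=
    hg.comp (measurable_prodMk_right (y := t))
  rw [lintegral_prod _ hgt.aemeasurable, lintegral_Ici_fst_mul_Ici_fst _ hr hs ht.1, mul_comm]

lemma measurable_cost_free_first (hc : Measurable c) (hu : Measurable u) (b : ℝ≥0∞) (n : ℕ)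
    (q : ℝ) :
    Measurable fun p : ℝ × (ℕ → ℝ) × (ℕ → ℝ) =>
      if p.1 ≤ q then truncCost c b u n (q - p.1 + 1) p.2.1 p.2.2 else 0 :=
  Measurable.ite (measurable_fst measurableSet_Iic)
    ((measurable_truncCost hc hu n).comp
      (((measurable_const.sub measurable_fst).add_const 1).prodMk measurable_snd)) measurable_const

lemma measurable_cost_costly_first (hc : Measurable c) (hu : Measurable u) (b : ℝ≥0∞) (n : ℕ)
    (q : ℝ) :
    Measurable fun p : ℝ × (ℕ → ℝ) × (ℕ → ℝ) =>
      if p.1 ≤ q then truncCost c b u n (q - p.1 + u (q - p.1)) p.2.2 p.2.1 else 0 := by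
  have hT := measurable_truncCost (b := b) hc hu n
  have hq1 : Measurable fun p : ℝ × (ℕ → ℝ) × (ℕ → ℝ) => q - p.1 :=
    measurable_const.sub measurable_fst
  have hcu : Measurable fun p : ℝ × (ℕ → ℝ) × (ℕ → ℝ) => (u (q - p.1) : ℝ) :=
    measurable_from_nat.comp (hu.comp hq1)
  exact Measurable.ite (measurable_fst measurableSet_Iic)
    (hT.comp ((hq1.add hcu).prodMk (measurable_snd.snd.prodMk measurable_snd.fst)))
    measurable_const

/-- The cost after the first arrival, when it is from the free server. -/
lemma lintegral_cost_free_first (hc : Measurable c) (hu : Measurable u) (hr : 0 < r) (hs : 0 < s)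
    (n : ℕ) (q : ℝ) :
    ∫⁻ p, ∫⁻ z, (Set.Ici p.1).indicator (fun e => if p.1 ≤ q then
      truncCost c b u n (q - p.1 + 1) p.2 (consSeq (e - p.1) z.2) else 0) z.1
        ∂((expMeasure s).prod (interarrivalLaw s)) ∂((expMeasure r).prod (interarrivalLaw r)) =
      ∫⁻ t in Set.Icc 0 q, ENNReal.ofReal (Real.exp (-((r + s) * t))) *
        (ENNReal.ofReal r * meanTruncCost r s c b u n (q - t + 1)) := by
  rw [lintegral_restart hr hs (K := fun a ξ y =>
    if a ≤ q then truncCost c b u n (q - a + 1) ξ y else 0)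
    (measurable_cost_free_first hc hu b n q),
    ← lintegral_indicator measurableSet_Ici, ← lintegral_indicator measurableSet_Icc]
  refine lintegral_congr fun t => ?_
  by_cases ht : 0 ≤ t
  · by_cases htq : t ≤ q
    · rw [Set.indicator_of_mem (Set.mem_Ici.2 ht), Set.indicator_of_mem (Set.mem_Icc.2 ⟨ht, htq⟩)]
      simp only [if_pos htq]
      rw [ENNReal.ofReal_mul hr.le, mul_comm (ENNReal.ofReal r), mul_assoc, meanTruncCost]
    · rw [Set.indicator_of_mem (Set.mem_Ici.2 ht), Set.indicator_of_notMem fun h => htq h.2]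
      simp [htq]
  · rw [Set.indicator_of_notMem (by simpa using ht), Set.indicator_of_notMem fun h => ht h.1]

/-- The cost after the first arrival, when it is from the costly server. -/
lemma lintegral_cost_costly_first (hc : Measurable c) (hu : Measurable u) (hr : 0 < r) (hs : 0 < s)
    (n : ℕ) (q : ℝ) :
    ∫⁻ p, ∫⁻ z, (Set.Ici z.1).indicator (fun a => if z.1 ≤ q then
      truncCost c b u n (q - z.1 + u (q - z.1)) (consSeq (a - z.1) p.2) z.2 else 0) p.1
        ∂((expMeasure s).prod (interarrivalLaw s)) ∂((expMeasure r).prod (interarrivalLaw r)) =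
      ∫⁻ t in Set.Icc 0 q, ENNReal.ofReal (Real.exp (-((r + s) * t))) *
        (ENNReal.ofReal s * meanTruncCost r s c b u n (q - t + u (q - t))) := by
  have := isProbabilityMeasure_expMeasure hr
  have := isProbabilityMeasure_interarrivalLaw hr
  have := isProbabilityMeasure_expMeasure hs
  have := isProbabilityMeasure_interarrivalLaw hs
  have hK₁ := measurable_cost_costly_first hc hu b n q
  have hf₃ : Measurable fun w : (ℝ × (ℕ → ℝ)) × (ℝ × (ℕ → ℝ)) =>
      (Set.Ici w.2.1).indicator (fun a => if w.2.1 ≤ q then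
      truncCost c b u n (q - w.2.1 + u (q - w.2.1)) (consSeq (a - w.2.1) w.1.2) w.2.2
        else 0) w.1.1 :=
    Measurable.ite (measurableSet_le measurable_snd.fst measurable_fst.fst)
      (hK₁.comp (measurable_snd.fst.prodMk (measurable_snd.snd.prodMk (Measurable.consSeq
        (measurable_fst.fst.sub measurable_snd.fst) measurable_fst.snd)))) measurable_const
  rw [lintegral_lintegral_swap hf₃.aemeasurable, lintegral_restart hs hr (K := fun e η x =>
    if e ≤ q then truncCost c b u n (q - e + u (q - e)) x η else 0) hK₁,
    ← lintegral_indicator measurableSet_Ici, ← lintegral_indicator measurableSet_Icc]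
  refine lintegral_congr fun t => ?_
  by_cases ht : 0 ≤ t
  · by_cases htq : t ≤ q
    · rw [Set.indicator_of_mem (Set.mem_Ici.2 ht), Set.indicator_of_mem (Set.mem_Icc.2 ⟨ht, htq⟩)]
      simp only [if_pos htq]
      rw [ENNReal.ofReal_mul hs.le, mul_comm (ENNReal.ofReal s), mul_assoc, meanTruncCost,
        add_comm s r, ← lintegral_prod_swap]
      rfl
    · rw [Set.indicator_of_mem (Set.mem_Ici.2 ht), Set.indicator_of_notMem fun h => htq h.2]
      simp [htq]
  · rw [Set.indicator_of_notMem (by simpa using ht), Set.indicator_of_notMem fun h => ht h.1]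

/-- The renewal inequality: the first arrival comes at rate `r + s`, and it belongs to the free
server with probability `r / (r + s)`. -/
lemma meanTruncCost_succ_le (hc : Measurable c) (hu : Measurable u) (hr : 0 < r) (hs : 0 < s)
    (n : ℕ) {q : ℝ} (hq : 0 ≤ q) :
    meanTruncCost r s c b u (n + 1) q ≤
      (∫⁻ t in Set.Icc 0 q, ENNReal.ofReal (Real.exp (-((r + s) * t))) *
        (c (q - t) + ENNReal.ofReal r * meanTruncCost r s c b u n (q - t + 1) +
          ENNReal.ofReal s * meanTruncCost r s c b u n (q - t + u (q - t)))) +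
      b * ENNReal.ofReal (Real.exp (-((r + s) * q))) := by
  have := isProbabilityMeasure_expMeasure hr
  have := isProbabilityMeasure_interarrivalLaw hr
  have := isProbabilityMeasure_expMeasure hs
  have := isProbabilityMeasure_interarrivalLaw hs
  have hI : ∀ t : ℝ, Measurable ((Set.Ici t).indicator (1 : ℝ → ℝ≥0∞)) := fun t =>
    measurable_one.indicator measurableSet_Ici
  have hf₂ : Measurable fun w : (ℝ × (ℕ → ℝ)) × (ℝ × (ℕ → ℝ)) =>
      (Set.Ici w.1.1).indicator (fun e => if w.1.1 ≤ q then
      truncCost c b u n (q - w.1.1 + 1) w.1.2 (consSeq (e - w.1.1) w.2.2) else 0) w.2.1 :=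
    Measurable.ite (measurableSet_le measurable_fst.fst measurable_snd.fst)
      ((measurable_cost_free_first hc hu b n q).comp (measurable_fst.fst.prodMk
        (measurable_fst.snd.prodMk (Measurable.consSeq
        (measurable_snd.fst.sub measurable_fst.fst) measurable_snd.snd)))) measurable_const
  have hf₃ : Measurable fun w : (ℝ × (ℕ → ℝ)) × (ℝ × (ℕ → ℝ)) =>
      (Set.Ici w.2.1).indicator (fun a => if w.2.1 ≤ q then
      truncCost c b u n (q - w.2.1 + u (q - w.2.1)) (consSeq (a - w.2.1) w.1.2) w.2.2
        else 0) w.1.1 :=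
    Measurable.ite (measurableSet_le measurable_snd.fst measurable_fst.fst)
      ((measurable_cost_costly_first hc hu b n q).comp (measurable_snd.fst.prodMk
        (measurable_snd.snd.prodMk (Measurable.consSeq
        (measurable_fst.fst.sub measurable_snd.fst) measurable_fst.snd)))) measurable_const
  have hf₄ : Measurable fun w : (ℝ × (ℕ → ℝ)) × (ℝ × (ℕ → ℝ)) =>
      b * (Set.Ici q).indicator 1 w.1.1 * (Set.Ici q).indicator 1 w.2.1 :=
    (((hI q).comp measurable_fst.fst).const_mul b).mul ((hI q).comp measurable_snd.fst)
  have hTq : Measurable fun p : (ℕ → ℝ) × (ℕ → ℝ) => truncCost c b u (n + 1) q p.1 p.2 :=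
    (measurable_truncCost (b := b) hc hu (n + 1)).comp measurable_prodMk_left
  rw [meanTruncCost, lintegral_interarrivalLaw_prod hr hs hTq]
  dsimp only
  have hle := lintegral_lintegral_le_add
    (κ := (expMeasure r).prod (interarrivalLaw r)) (ν := (expMeasure s).prod (interarrivalLaw s))
    (F := fun p z => truncCost c b u (n + 1) q (consSeq p.1 p.2) (consSeq z.1 z.2))
    (fun w => ∫⁻ t in Set.Icc 0 q,
      (c (q - t) * (Set.Ici t).indicator 1 w.1.1 * (Set.Ici t).indicator 1 w.2.1))
    (fun w => (Set.Ici w.1.1).indicator (fun e => if w.1.1 ≤ q then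
      truncCost c b u n (q - w.1.1 + 1) w.1.2 (consSeq (e - w.1.1) w.2.2) else 0) w.2.1)
    (fun w => (Set.Ici w.2.1).indicator (fun a => if w.2.1 ≤ q then
      truncCost c b u n (q - w.2.1 + u (q - w.2.1)) (consSeq (a - w.2.1) w.1.2) w.2.2 else 0) w.1.1)
    (fun w => b * (Set.Ici q).indicator 1 w.1.1 * (Set.Ici q).indicator 1 w.2.1)
    (fun p z => truncCost_succ_le n q p.1 z.1 p.2 z.2) hf₂ hf₃ hf₄
  dsimp only at hle
  refine hle.trans ?_
  rw [lintegral_cost_before_arrival hc hr hs, lintegral_cost_free_first hc hu hr hs,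
    lintegral_cost_costly_first hc hu hr hs, lintegral_Ici_fst_mul_Ici_fst b hr hs hq]
  gcongr
  refine (add_le_add_left (le_lintegral_add _ _) _).trans ((le_lintegral_add _ _).trans ?_)
  simp only [mul_add, le_refl]

/-- Comparison principle: a solution `V` of the renewal inequality dominates the mean costs. -/
lemma meanTruncCost_le (hc : Measurable c) (hu : Measurable u) (hr : 0 < r) (hs : 0 < s)
    {V : ℝ → ℝ≥0∞}
    (hV : ∀ q, 0 ≤ q → (∫⁻ t in Set.Icc 0 q, ENNReal.ofReal (Real.exp (-((r + s) * t))) *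
        (c (q - t) + ENNReal.ofReal r * V (q - t + 1) +
          ENNReal.ofReal s * V (q - t + u (q - t)))) +
      b * ENNReal.ofReal (Real.exp (-((r + s) * q))) ≤ V q)
    (n : ℕ) {q : ℝ} (hq : 0 ≤ q) : meanTruncCost r s c b u n q ≤ V q := by
  induction n generalizing q with
  | zero => simp [meanTruncCost, truncCost]
  | succ n ih =>
    refine (meanTruncCost_succ_le hc hu hr hs n hq).trans (le_trans ?_ (hV q hq))
    refine add_le_add_left (setLIntegral_mono' measurableSet_Icc fun t ht => ?_) _
    have h0 : 0 ≤ q - t := sub_nonneg.2 ht.2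
    have hu0 : (0 : ℝ) ≤ u (q - t) := Nat.cast_nonneg _
    gcongr
    · exact ih (by linarith)
    · exact ih (by linarith)

open scoped Classical in
/-- A solution `V` of the renewal inequality bounds the mean total cost of the controlled buffer.
The cost is dominated by a measurable variable, so that the bound also applies to the outer
measure of the event of interruption. -/
lemma exists_cost_le {Ω : Type*} [MeasurableSpace Ω] {μ : Measure Ω} [IsProbabilityMeasure μ]
    {X Y : ℕ → Ω → ℝ} (hX : IsPoissonInterarrival X r μ) (hY : IsPoissonInterarrival Y s μ)
    (hXY : IndepFun (fun ω n => X n ω) (fun ω n => Y n ω) μ)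
    (hc : Measurable c) (hu : Measurable u) (hr : 0 < r) (hs : 0 < s) {V : ℝ → ℝ≥0∞}
    (hV : ∀ q, 0 ≤ q → (∫⁻ t in Set.Icc 0 q, ENNReal.ofReal (Real.exp (-((r + s) * t))) *
        (c (q - t) + ENNReal.ofReal r * V (q - t + 1) +
          ENNReal.ofReal s * V (q - t + u (q - t)))) +
      b * ENNReal.ofReal (Real.exp (-((r + s) * q))) ≤ V q)
    {q : ℝ} (hq : 0 ≤ q) :
    ∃ F : Ω → ℝ≥0∞, AEMeasurable F μ ∧ ∫⁻ ω, F ω ∂μ ≤ V q ∧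
      ∀ᵐ ω ∂μ, (∫⁻ t in {t : ℝ | 0 ≤ t ∧
          (t : EReal) < interruptionTime (bufferSize u q (fun n => X n ω) (fun n => Y n ω))},
            c (bufferSize u q (fun n => X n ω) (fun n => Y n ω) t)) +
        (if interruptionTime (bufferSize u q (fun n => X n ω) (fun n => Y n ω)) < ⊤ then b else 0) ≤
          F ω := by
  have hlaw : ∀ {Z : ℕ → Ω → ℝ} {ρ : ℝ}, IsPoissonInterarrival Z ρ μ →
      μ.map (fun ω n => Z n ω) = interarrivalLaw ρ := fun {Z ρ} hZ => by
    rw [hZ.indep.map_fun_eq_infinitePi_map₀' fun n => (hZ.hasLaw n).aemeasurable]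
    simp only [(hZ.hasLaw _).map_eq, interarrivalLaw]
  have hXm : AEMeasurable (fun ω n => X n ω) μ := aemeasurable_pi_iff.2 fun n =>
    (hX.hasLaw n).aemeasurable
  have hYm : AEMeasurable (fun ω n => Y n ω) μ := aemeasurable_pi_iff.2 fun n =>
    (hY.hasLaw n).aemeasurable
  have hXreg : ∀ᵐ ω ∂μ, IsRegularPath fun n => X n ω :=
    ae_of_ae_map hXm (by rw [hlaw hX]; exact ae_isRegularPath hr)
  have hYreg : ∀ᵐ ω ∂μ, IsRegularPath fun n => Y n ω :=
    ae_of_ae_map hYm (by rw [hlaw hY]; exact ae_isRegularPath hs)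
  have hm : ∀ n, Measurable fun p : (ℕ → ℝ) × (ℕ → ℝ) => truncCost c b u n q p.1 p.2 := fun n =>
    (measurable_truncCost (b := b) hc hu n).comp measurable_prodMk_left
  have hjoint : μ.map (fun ω => ((fun n => X n ω), fun n => Y n ω)) =
      (interarrivalLaw r).prod (interarrivalLaw s) := by
    have := isProbabilityMeasure_interarrivalLaw hr
    have := isProbabilityMeasure_interarrivalLaw hs
    rw [(indepFun_iff_map_prod_eq_prod_map_map hXm hYm).1 hXY, hlaw hX, hlaw hY]
  refine ⟨fun ω => ⨆ n, truncCost c b u n q (fun n => X n ω) (fun n => Y n ω),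
    (Measurable.iSup hm).comp_aemeasurable (hXm.prodMk hYm), ?_, ?_⟩
  · calc _ = ∫⁻ p, ⨆ n, truncCost c b u n q p.1 p.2
          ∂((interarrivalLaw r).prod (interarrivalLaw s)) := by
          rw [← hjoint, lintegral_map' (Measurable.iSup hm).aemeasurable (hXm.prodMk hYm)]
      _ = ⨆ n, meanTruncCost r s c b u n q :=
          lintegral_iSup hm (monotone_nat_of_le_succ fun n p => truncCost_le_succ n q p.1 p.2)
      _ ≤ V q := iSup_le fun n => meanTruncCost_le hc hu hr hs hV n hq
  · filter_upwards [hXreg, hYreg] with ω hx hy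
    exact cost_le_iSup_truncCost hc hx hy hq

end Mean

/-! ### The interruption exponents -/

lemma interruptionExponent_root {R : ℝ} (hR : 0 ≤ R) :
    interruptionExponent R + R * (Real.exp (-interruptionExponent R) - 1) = 0 :=
  (isGreatest_interruptionExponent hR).1

lemma lt_interruptionExponent {R x : ℝ} (hR : 0 ≤ R) (hx : x + R * (Real.exp (-x) - 1) < 0) :
    x < interruptionExponent R := by
  have hxR : x ≤ R := by nlinarith [mul_nonneg hR (Real.exp_pos (-x)).le]
  have hcont : ContinuousOn (fun r => r + R * (Real.exp (-r) - 1)) (Set.Icc x R) := by fun_prop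
  obtain ⟨z, hz, hz0⟩ := intermediate_value_Icc hxR hcont
    (show (0 : ℝ) ∈ Set.Icc _ _ from ⟨hx.le, by nlinarith [mul_nonneg hR (Real.exp_pos (-R)).le]⟩)
  have hxz : x ≠ z := fun h => by
    subst h
    exact hx.ne hz0
  exact (lt_of_le_of_ne hz.1 hxz).trans_le ((isGreatest_interruptionExponent hR).2 hz0)

lemma interruptionExponent_pos {R : ℝ} (hR : 1 < R) : 0 < interruptionExponent R := by
  -- `γ` is negative at the midpoint `x` between `0` and `R - 1`.
  set x := (R - 1) / 2 with hx
  have hx0 : 0 < x := by linarith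
  refine hx0.trans (lt_interruptionExponent (by linarith) ?_)
  have h1 : Real.exp (-x) * Real.exp x = 1 := by rw [← Real.exp_add]; simp
  have h2 : Real.exp (-x) * (1 + x) ≤ 1 :=
    (mul_le_mul_of_nonneg_left (by linarith [Real.add_one_le_exp x]) (Real.exp_pos _).le).trans
      h1.le
  have h3 : (x + R * (Real.exp (-x) - 1)) * (1 + x) < 0 := by nlinarith
  exact neg_of_mul_neg_left h3 (by linarith)

lemma interruptionExponent_lt {R₀ R₁ : ℝ} (hR₀ : 1 < R₀) (hR : R₀ < R₁) :
    interruptionExponent R₀ < interruptionExponent R₁ := by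
  refine lt_interruptionExponent (by linarith) ?_
  have h1 := interruptionExponent_root (R := R₀) (by linarith)
  have h2 : Real.exp (-interruptionExponent R₀) < 1 :=
    Real.exp_lt_one_iff.2 (by linarith [interruptionExponent_pos hR₀])
  nlinarith

lemma mul_le_one_sub_exp_neg {α x : ℝ} (hα : 0 ≤ α) (hx : 0 ≤ x) (hx1 : x ≤ 1) :
    α * (1 - α / 2) * x ≤ 1 - Real.exp (-(α * x)) := by
  set y := α * x with hy
  have hy0 : 0 ≤ y := mul_nonneg hα hx
  have h1 : Real.exp (-y) * Real.exp y = 1 := by rw [← Real.exp_add]; simp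
  have h2 : Real.exp (-y) ≤ 1 - y + y ^ 2 / 2 := by
    have h3 := Real.quadratic_le_exp_of_nonneg hy0
    have h4 : Real.exp (-y) * (1 + y + y ^ 2 / 2) ≤ 1 :=
      (mul_le_mul_of_nonneg_left h3 (Real.exp_pos _).le).trans h1.le
    have h5 : 1 ≤ (1 - y + y ^ 2 / 2) * (1 + y + y ^ 2 / 2) := by nlinarith [sq_nonneg (y ^ 2)]
    exact le_of_mul_le_mul_right (h4.trans h5) (by positivity)
  have h6 : y ^ 2 ≤ α ^ 2 * x := by
    rw [hy, mul_pow]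
    gcongr
    nlinarith
  nlinarith

/-! ### Barriers for the risky policy -/

/-- The integrated form of the differential inequality `w ≤ V' + κ V`. -/
lemma lintegral_renewal_le {V V' : ℝ → ℝ} {w : ℝ → ℝ≥0∞} {b : ℝ≥0∞} {κ q : ℝ} (hq : 0 ≤ q)
    (hcont : Continuous V) (hderiv : ∀ p, 0 < p → HasDerivWithinAt V (V' p) (Set.Ioi p) p)
    (hnn : ∀ p, 0 < p → 0 ≤ V' p + κ * V p)
    (hw : ∀ p, 0 < p → w p ≤ ENNReal.ofReal (V' p + κ * V p))
    (hV0 : 0 ≤ V 0) (hb : b ≤ ENNReal.ofReal (V 0)) :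
    (∫⁻ t in Set.Icc 0 q, ENNReal.ofReal (Real.exp (-(κ * t))) * w (q - t)) +
      b * ENNReal.ofReal (Real.exp (-(κ * q))) ≤ ENNReal.ofReal (V q) := by
  set g : ℝ → ℝ := fun p => Real.exp (-(κ * (q - p))) * V p with hg
  set g' : ℝ → ℝ := fun p => Real.exp (-(κ * (q - p))) * (V' p + κ * V p) with hg'
  have hgc : ContinuousOn g (Set.Icc 0 q) := by
    refine Continuous.continuousOn ?_
    fun_prop
  have hgd : ∀ p ∈ Set.Ioo 0 q, HasDerivWithinAt g (g' p) (Set.Ioi p) p := fun p hp => by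
    have h1 : HasDerivAt (fun p => Real.exp (-(κ * (q - p))))
        (Real.exp (-(κ * (q - p))) * κ) p := by
      have h2 : HasDerivAt (fun p => -(κ * (q - p))) κ p := by
        have := (((hasDerivAt_id p).const_sub q).const_mul κ).fun_neg
        simpa using this
      exact h2.exp
    refine (h1.hasDerivWithinAt.mul (hderiv p hp.1)).congr_deriv ?_
    simp only [hg']
    ring
  have hg'nn : ∀ p ∈ Set.Ioo 0 q, 0 ≤ g' p := fun p hp =>
    mul_nonneg (Real.exp_pos _).le (hnn p hp.1)
  have hint : IntegrableOn g' (Set.Ioc 0 q) :=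
    intervalIntegral.integrableOn_deriv_right_of_nonneg hgc hgd hg'nn
  have hFTC : ∫ p in Set.Ioo 0 q, g' p = g q - g 0 := by
    rw [← integral_Ioc_eq_integral_Ioo, ← intervalIntegral.integral_of_le hq]
    exact intervalIntegral.integral_eq_sub_of_hasDeriv_right_of_le hq hgc hgd
      ((intervalIntegrable_iff_integrableOn_Ioc_of_le hq).2 hint)
  have hpos : 0 ≤ g q - g 0 := by
    rw [← hFTC]
    exact setIntegral_nonneg measurableSet_Ioo hg'nn
  have hrefl : ∫⁻ t in Set.Icc 0 q, ENNReal.ofReal (Real.exp (-(κ * t))) * w (q - t) =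
      ∫⁻ p in Set.Icc 0 q, ENNReal.ofReal (Real.exp (-(κ * (q - p)))) * w p := by
    rw [← lintegral_indicator measurableSet_Icc, ← lintegral_indicator measurableSet_Icc,
      ← lintegral_sub_left_eq_self _ q]
    refine lintegral_congr fun p => ?_
    by_cases hp : p ∈ Set.Icc 0 q
    · rw [Set.indicator_of_mem hp, Set.indicator_of_mem
        (show q - p ∈ Set.Icc 0 q from ⟨by linarith [hp.2], by linarith [hp.1]⟩), sub_sub_cancel]
    · rw [Set.indicator_of_notMem hp, Set.indicator_of_notMem]
      exact fun h => hp ⟨by linarith [h.2], by linarith [h.1]⟩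
  have hmain : ∫⁻ t in Set.Icc 0 q, ENNReal.ofReal (Real.exp (-(κ * t))) * w (q - t) ≤
      ENNReal.ofReal (g q - g 0) := by
    rw [hrefl, ← Measure.restrict_congr_set Ioo_ae_eq_Icc, ← hFTC,
      ofReal_integral_eq_lintegral_ofReal (hint.mono_set Set.Ioo_subset_Ioc_self)
        (ae_restrict_of_forall_mem measurableSet_Ioo hg'nn)]
    refine setLIntegral_mono' measurableSet_Ioo fun p hp => ?_
    rw [hg', ENNReal.ofReal_mul (Real.exp_pos _).le]
    gcongr
    exact hw p hp.1
  have hb' : b * ENNReal.ofReal (Real.exp (-(κ * q))) ≤ ENNReal.ofReal (g 0) := by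
    simp only [hg, sub_zero]
    rw [mul_comm, ENNReal.ofReal_mul (Real.exp_pos _).le]
    gcongr
  have hg0 : 0 ≤ g 0 := mul_nonneg (Real.exp_pos _).le hV0
  refine (add_le_add hmain hb').trans ?_
  rw [← ENNReal.ofReal_add hpos hg0, sub_add_cancel]
  simp [hg]

/-- The barrier functions: solutions of the Kolmogorov backward equation of the buffer with
running cost `k (R₁ - 1)` below the threshold `T` and no running cost above it, except that below
the threshold the jumps across it are ignored. -/
def barrier (α₀ α₁ T A B C k p : ℝ) : ℝ :=
  if T ≤ p then C * Real.exp (-(α₀ * (p - T))) else A - B * Real.exp (-(α₁ * p)) - k * p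

section Barrier

variable {R₀ R₁ α₀ α₁ T A B C k : ℝ}

lemma barrier_of_le (p : ℝ) (hC : A - B * Real.exp (-(α₁ * T)) - k * T = C) (hp : p ≤ T) :
    barrier α₀ α₁ T A B C k p = A - B * Real.exp (-(α₁ * p)) - k * p := by
  rcases hp.eq_or_lt with rfl | h
  · simp [barrier, hC]
  · simp [barrier, h]

lemma barrier_of_ge {p : ℝ} (hp : T ≤ p) :
    barrier α₀ α₁ T A B C k p = C * Real.exp (-(α₀ * (p - T))) := if_pos hp

lemma continuous_barrier (hC : A - B * Real.exp (-(α₁ * T)) - k * T = C) :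
    Continuous (barrier α₀ α₁ T A B C k) := by
  refine Continuous.if_le (by fun_prop) (by fun_prop) continuous_const continuous_id ?_
  rintro p rfl
  simp [hC]

lemma hasDerivWithinAt_barrier (p : ℝ) : HasDerivWithinAt (barrier α₀ α₁ T A B C k)
    (if T ≤ p then -(α₀ * (C * Real.exp (-(α₀ * (p - T)))))
      else B * α₁ * Real.exp (-(α₁ * p)) - k) (Set.Ioi p) p := by
  split_ifs with h
  · have h1 : HasDerivAt (fun p => C * Real.exp (-(α₀ * (p - T))))
        (-(α₀ * (C * Real.exp (-(α₀ * (p - T)))))) p := by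
      have h2 : HasDerivAt (fun p => -(α₀ * (p - T))) (-α₀) p := by
        simpa using (((hasDerivAt_id p).sub_const T).const_mul α₀).fun_neg
      refine (h2.exp.const_mul C).congr_deriv ?_
      ring
    exact h1.hasDerivWithinAt.congr (fun x hx => barrier_of_ge (h.trans (le_of_lt hx)))
      (barrier_of_ge h)
  · have h1 : HasDerivAt (fun p => A - B * Real.exp (-(α₁ * p)) - k * p)
        (B * α₁ * Real.exp (-(α₁ * p)) - k) p := by
      have h2 : HasDerivAt (fun p => -(α₁ * p)) (-α₁) p := by
        simpa using ((hasDerivAt_id p).const_mul α₁).fun_neg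
      have h3 : HasDerivAt (fun p => k * p) k p := by
        simpa using (hasDerivAt_id p).const_mul k
      refine (((h2.exp.const_mul B).const_sub A).sub h3).congr_deriv ?_
      ring
    refine HasDerivAt.hasDerivWithinAt (h1.congr_of_eventuallyEq ?_)
    filter_upwards [gt_mem_nhds (not_le.1 h)] with x hx
    exact if_neg (not_le.2 hx)

lemma measurable_riskyPolicy (T : ℝ) : Measurable (riskyPolicy T) :=
  Measurable.ite measurableSet_Ioo measurable_const measurable_const

/-- A barrier that lies below the continuation of its lower branch on `[T, T + 1]` is a solution of
the renewal inequality. -/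
lemma barrier_renewal_le (hR₀ : 0 < R₀) (hR : R₀ < R₁) (hR₁ : 1 < R₁) (hk : 0 ≤ k)
    (hα₀ : α₀ + R₀ * (Real.exp (-α₀) - 1) = 0) (hα₁ : α₁ + R₁ * (Real.exp (-α₁) - 1) = 0)
    (hC : A - B * Real.exp (-(α₁ * T)) - k * T = C)
    (hcross : ∀ x, 0 ≤ x → x ≤ 1 → C * Real.exp (-(α₀ * x)) ≤
      A - B * Real.exp (-(α₁ * (T + x))) - k * (T + x))
    (hnn : ∀ p, 0 ≤ p → 0 ≤ barrier α₀ α₁ T A B C k p)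
    {b : ℝ≥0∞} (hb : b ≤ ENNReal.ofReal (barrier α₀ α₁ T A B C k 0)) {q : ℝ} (hq : 0 ≤ q) :
    (∫⁻ t in Set.Icc 0 q, ENNReal.ofReal (Real.exp (-((R₀ + (R₁ - R₀)) * t))) *
        (ENNReal.ofReal (k * (R₁ - 1)) * (riskyPolicy T (q - t) : ℝ≥0∞) +
          ENNReal.ofReal R₀ * ENNReal.ofReal (barrier α₀ α₁ T A B C k (q - t + 1)) +
          ENNReal.ofReal (R₁ - R₀) *
            ENNReal.ofReal (barrier α₀ α₁ T A B C k (q - t + riskyPolicy T (q - t))))) +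
      b * ENNReal.ofReal (Real.exp (-((R₀ + (R₁ - R₀)) * q))) ≤
        ENNReal.ofReal (barrier α₀ α₁ T A B C k q) := by
  set V := barrier α₀ α₁ T A B C k with hV
  set V' : ℝ → ℝ := fun p => if T ≤ p then -(α₀ * (C * Real.exp (-(α₀ * (p - T)))))
      else B * α₁ * Real.exp (-(α₁ * p)) - k with hV'
  -- The backward inequality, with real values.
  have hkey : ∀ p, 0 < p → k * (R₁ - 1) * riskyPolicy T p + R₀ * V (p + 1) +
      (R₁ - R₀) * V (p + riskyPolicy T p) ≤ V' p + (R₀ + (R₁ - R₀)) * V p := by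
    intro p hp
    by_cases h : T ≤ p
    · have hu : riskyPolicy T p = 0 := if_neg fun h' => absurd h'.2 (not_lt.2 h)
      have h1 : V (p + 1) = V p * Real.exp (-α₀) := by
        rw [hV, barrier_of_ge h, barrier_of_ge (by linarith), mul_assoc, ← Real.exp_add]
        ring_nf
      have h2 : V' p = -(α₀ * V p) := by
        rw [hV, barrier_of_ge h]
        exact if_pos h
      rw [hu, h1, h2]
      simp only [Nat.cast_zero, mul_zero, add_zero]
      refine le_of_eq ?_
      linear_combination (-V p) * (-hα₀)
    · have hu : riskyPolicy T p = 1 := if_pos ⟨hp, not_le.1 h⟩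
      have h1 : V (p + 1) ≤ A - B * (Real.exp (-(α₁ * p)) * Real.exp (-α₁)) - k * (p + 1) := by
        have h3 : Real.exp (-(α₁ * p)) * Real.exp (-α₁) = Real.exp (-(α₁ * (p + 1))) := by
          rw [← Real.exp_add]
          ring_nf
        rw [h3]
        rcases le_total (p + 1) T with h4 | h4
        · exact (barrier_of_le _ hC h4).le
        · have h5 := hcross (p + 1 - T) (by linarith) (by linarith [not_le.1 h])
          rw [add_sub_cancel] at h5
          exact (barrier_of_ge h4).le.trans h5
      have h2 : V' p = B * α₁ * Real.exp (-(α₁ * p)) - k := if_neg h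
      have h3 : V p = A - B * Real.exp (-(α₁ * p)) - k * p := if_neg h
      rw [hu, h2, h3]
      simp only [Nat.cast_one, mul_one]
      have h4 := mul_le_mul_of_nonneg_left h1 (show 0 ≤ R₁ by linarith)
      have h5 : R₁ * (A - B * (Real.exp (-(α₁ * p)) * Real.exp (-α₁)) - k * (p + 1)) =
          B * α₁ * Real.exp (-(α₁ * p)) - k + R₁ * (A - B * Real.exp (-(α₁ * p)) - k * p) -
            k * (R₁ - 1) := by
        linear_combination (-B * Real.exp (-(α₁ * p))) * hα₁
      linarith
  have hpos : ∀ p, 0 < p → 0 ≤ k * (R₁ - 1) * riskyPolicy T p ∧ 0 ≤ R₀ * V (p + 1) ∧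
      0 ≤ (R₁ - R₀) * V (p + riskyPolicy T p) := fun p hp => by
    have hu : (0 : ℝ) ≤ riskyPolicy T p := Nat.cast_nonneg _
    exact ⟨mul_nonneg (mul_nonneg hk (by linarith)) hu,
      mul_nonneg hR₀.le (hnn _ (by linarith)), mul_nonneg (by linarith) (hnn _ (by linarith))⟩
  refine lintegral_renewal_le (V' := V') (w := fun p =>
    ENNReal.ofReal (k * (R₁ - 1)) * (riskyPolicy T p : ℝ≥0∞) +
      ENNReal.ofReal R₀ * ENNReal.ofReal (V (p + 1)) +
      ENNReal.ofReal (R₁ - R₀) * ENNReal.ofReal (V (p + riskyPolicy T p))) hq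
    (continuous_barrier hC) (fun p _ => hasDerivWithinAt_barrier p) (fun p hp => ?_)
    (fun p hp => ?_) (hnn 0 le_rfl) hb
  · obtain ⟨h1, h2, h3⟩ := hpos p hp
    linarith [hkey p hp]
  · obtain ⟨h1, h2, h3⟩ := hpos p hp
    refine le_trans (le_of_eq ?_) (ENNReal.ofReal_le_ofReal (hkey p hp))
    rw [ENNReal.ofReal_add (add_nonneg h1 h2) h3, ENNReal.ofReal_add h1 h2,
      ENNReal.ofReal_mul (mul_nonneg hk (by linarith)), ENNReal.ofReal_natCast,
      ENNReal.ofReal_mul hR₀.le, ENNReal.ofReal_mul (by linarith : 0 ≤ R₁ - R₀)]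

end Barrier

/-! ### Interruption probability and usage of the risky policy -/

lemma one_lt_riskyBeta {R₀ R₁ : ℝ} (hR₀ : 1 < R₀) (hR : R₀ < R₁)
    (h2 : interruptionExponent R₀ < 2) : 1 < riskyBeta R₀ R₁ := by
  have h0 := interruptionExponent_pos hR₀
  have h1 := interruptionExponent_lt hR₀ hR
  have h3 : 0 < interruptionExponent R₀ * (1 - interruptionExponent R₀ / 2) :=
    mul_pos h0 (by linarith)
  rw [riskyBeta, one_lt_div h3]
  nlinarith

/-- The choice of `β`: the ratio of `1 - exp (-α₀ x)` to a line through the origin is worst at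
`x = 1`. -/
lemma mul_le_riskyBeta_mul {R₀ R₁ : ℝ} (hR₀ : 1 < R₀) (hR : R₀ < R₁)
    (h2 : interruptionExponent R₀ < 2) {x : ℝ} (hx : 0 ≤ x) (hx1 : x ≤ 1) :
    interruptionExponent R₁ * x ≤
      riskyBeta R₀ R₁ * (1 - Real.exp (-(interruptionExponent R₀ * x))) := by
  have h0 := interruptionExponent_pos hR₀
  have hβ := one_lt_riskyBeta hR₀ hR h2
  have h3 : 0 < interruptionExponent R₀ * (1 - interruptionExponent R₀ / 2) :=
    mul_pos h0 (by linarith)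
  have h4 : riskyBeta R₀ R₁ * (interruptionExponent R₀ * (1 - interruptionExponent R₀ / 2)) =
      interruptionExponent R₁ := div_mul_cancel₀ _ h3.ne'
  rw [← h4, mul_assoc]
  exact mul_le_mul_of_nonneg_left (mul_le_one_sub_exp_neg h0.le hx hx1) (by linarith)

section Risky

variable {Ω : Type*} [MeasurableSpace Ω] {μ : Measure Ω} [IsProbabilityMeasure μ]
  {R₀ R₁ T D : ℝ} {X Y : ℕ → Ω → ℝ}

/-- The interruption probability is bounded by the barrier with `k = 0` which equals `1` at the
empty buffer. -/
lemma interruptionProb_riskyPolicy_le (hR₀ : 1 < R₀) (hR : R₀ < R₁)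
    (hX : IsPoissonInterarrival X R₀ μ) (hY : IsPoissonInterarrival Y (R₁ - R₀) μ)
    (hXY : IndepFun (fun ω n => X n ω) (fun ω n => Y n ω) μ)
    {α₀ α₁ β : ℝ} (hα₀ : α₀ = interruptionExponent R₀) (hα₁ : α₁ = interruptionExponent R₁)
    (hβ : β = riskyBeta R₀ R₁) (h2 : α₀ < 2) (hT : 0 < T) (hD : 0 ≤ D) :
    interruptionProb μ X Y (riskyPolicy T) D ≤
      ENNReal.ofReal ((if T ≤ D then β * Real.exp (-(α₀ * (D - T)))
        else β - 1 + Real.exp (α₁ * T) * Real.exp (-(α₁ * D))) /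
          (Real.exp (α₁ * T) + β - 1)) := by
  have hβ1 : 1 < β := hβ ▸ one_lt_riskyBeta hR₀ hR (hα₀ ▸ h2)
  have hE := Real.exp_pos (α₁ * T)
  set E := Real.exp (α₁ * T) with hEdef
  set a := 1 / (E + β - 1) with ha
  have hden : 0 < E + β - 1 := by linarith
  have ha0 : 0 < a := one_div_pos.2 hden
  have haE : a * (E + β - 1) = 1 := one_div_mul_cancel hden.ne'
  have hexp : E * Real.exp (-(α₁ * T)) = 1 := by rw [hEdef, ← Real.exp_add]; simp
  have hC : a * (β - 1) - -(a * E) * Real.exp (-(α₁ * T)) - 0 * T = a * β := by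
    linear_combination a * hexp
  set V := barrier α₀ α₁ T (a * (β - 1)) (-(a * E)) (a * β) 0 with hV
  have hnn : ∀ p, 0 ≤ p → 0 ≤ V p := fun p _ => by
    have h3 : 0 < β - 1 := by linarith
    have h4 : 0 < β := by linarith
    simp only [hV, barrier, neg_mul, sub_neg_eq_add, zero_mul, sub_zero]
    split_ifs <;> positivity
  have hcross : ∀ x, 0 ≤ x → x ≤ 1 → a * β * Real.exp (-(α₀ * x)) ≤
      a * (β - 1) - -(a * E) * Real.exp (-(α₁ * (T + x))) - 0 * (T + x) := fun x hx hx1 => by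
    have h3 : Real.exp (-(α₁ * (T + x))) = Real.exp (-(α₁ * T)) * Real.exp (-(α₁ * x)) := by
      rw [← Real.exp_add]
      ring_nf
    have h4 : α₁ * x ≤ β * (1 - Real.exp (-(α₀ * x))) := by
      rw [hα₀, hα₁, hβ]
      exact mul_le_riskyBeta_mul hR₀ hR (hα₀ ▸ h2) hx hx1
    have h5 := Real.add_one_le_exp (-(α₁ * x))
    have h6 : a * (β - 1) - -(a * E) * Real.exp (-(α₁ * (T + x))) - 0 * (T + x) =
        a * (β - 1 + Real.exp (-(α₁ * x))) := by
      rw [h3]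
      linear_combination a * Real.exp (-(α₁ * x)) * hexp
    rw [h6, mul_assoc]
    exact mul_le_mul_of_nonneg_left (by linarith) ha0.le
  have hV0 : V 0 = 1 := by
    rw [hV, barrier_of_le 0 hC hT.le]
    simp only [mul_zero, neg_zero, Real.exp_zero]
    linear_combination haE
  have hb : (1 : ℝ≥0∞) ≤ ENNReal.ofReal (V 0) := by rw [hV0]; simp
  have hroot₀ := interruptionExponent_root (R := R₀) (by linarith)
  have hroot₁ := interruptionExponent_root (R := R₁) (by linarith)
  rw [← hα₀] at hroot₀
  rw [← hα₁] at hroot₁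
  have hsuper := fun q (hq : 0 ≤ q) => barrier_renewal_le (R₀ := R₀) (R₁ := R₁) (by linarith) hR
    (by linarith) le_rfl hroot₀ hroot₁ hC hcross hnn hb hq
  obtain ⟨F, hFm, hF, hle⟩ := exists_cost_le hX hY hXY
    (c := fun p => ENNReal.ofReal (0 * (R₁ - 1)) * (riskyPolicy T p : ℝ≥0∞))
    ((measurable_from_nat.comp (measurable_riskyPolicy T)).const_mul _) (measurable_riskyPolicy T)
    (by linarith) (by linarith) hsuper hD
  have hVD : V D = (if T ≤ D then β * Real.exp (-(α₀ * (D - T)))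
        else β - 1 + E * Real.exp (-(α₁ * D))) / (E + β - 1) := by
    rw [div_eq_mul_one_div, ← ha]
    simp only [hV, barrier]
    split_ifs <;> ring
  rw [← hVD]
  calc interruptionProb μ X Y (riskyPolicy T) D ≤ μ {ω | 1 ≤ F ω} := by
        refine measure_mono_ae ?_
        filter_upwards [hle] with ω hω hlt
        have hlt' : interruptionTime (bufferSize (riskyPolicy T) D (fun n => X n ω)
          (fun n => Y n ω)) < ⊤ := hlt
        rw [if_pos hlt'] at hω
        exact le_add_self.trans hω
    _ ≤ ∫⁻ ω, F ω ∂μ := by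
        simpa using mul_meas_ge_le_lintegral₀ hFm 1
    _ ≤ _ := hF

/-- The expected usage is bounded by the barrier with `k = 1 / (R₁ - 1)` which vanishes at the
empty buffer. -/
lemma expectedUsage_riskyPolicy_le (hR₀ : 1 < R₀) (hR : R₀ < R₁)
    (hX : IsPoissonInterarrival X R₀ μ) (hY : IsPoissonInterarrival Y (R₁ - R₀) μ)
    (hXY : IndepFun (fun ω n => X n ω) (fun ω n => Y n ω) μ)
    {α₀ α₁ β : ℝ} (hα₀ : α₀ = interruptionExponent R₀) (hα₁ : α₁ = interruptionExponent R₁)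
    (hβ : β = riskyBeta R₀ R₁) (h2 : α₀ < 2) (hT : 0 < T) (hD : 0 ≤ D) :
    (T ≤ D → expectedUsage μ X Y (riskyPolicy T) D ≤
      ENNReal.ofReal (β / (α₁ * (R₁ - 1)) * Real.exp (-(α₀ * (D - T))))) ∧
    (D ≤ T → expectedUsage μ X Y (riskyPolicy T) D ≤
      ENNReal.ofReal ((1 - Real.exp (-(α₁ * D))) / ((R₁ - 1) * (1 - Real.exp (-(α₁ * T)))) *
        (T + β / α₁) - D / (R₁ - 1))) := by
  have hβ1 : 1 < β := hβ ▸ one_lt_riskyBeta hR₀ hR (hα₀ ▸ h2)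
  have hα₁pos : 0 < α₁ := hα₁ ▸ interruptionExponent_pos (hR₀.trans hR)
  have hR1 : 0 < R₁ - 1 := by linarith
  set k := 1 / (R₁ - 1) with hk
  have hk0 : 0 < k := one_div_pos.2 hR1
  have hkR : k * (R₁ - 1) = 1 := one_div_mul_cancel hR1.ne'
  set e := Real.exp (-(α₁ * T)) with he
  have he0 : 0 < e := Real.exp_pos _
  have he1 : 0 < 1 - e := sub_pos.2 (Real.exp_lt_one_iff.2 (by nlinarith))
  set C := β * k / α₁ with hCdef
  have hC0 : 0 < C := by positivity
  set A := (C + k * T) / (1 - e) with hA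
  have hA0 : 0 < A := by positivity
  have hAe : A * (1 - e) = C + k * T := div_mul_cancel₀ _ he1.ne'
  have hC : A - A * Real.exp (-(α₁ * T)) - k * T = C := by
    rw [← he]
    linarith
  set V := barrier α₀ α₁ T A A C k with hV
  have hnn : ∀ p, 0 ≤ p → 0 ≤ V p := fun p hp => by
    rcases le_total T p with h | h
    · rw [hV, barrier_of_ge h]
      positivity
    · rw [hV, barrier_of_le p hC h]
      -- The lower branch is concave on `[0, T]` and nonnegative at both ends.
      have h3 : Real.exp (-(α₁ * p)) ≤ (1 - p / T) + p / T * e := by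
        have h4 := convexOn_exp.2 (Set.mem_univ 0) (Set.mem_univ (-(α₁ * T)))
          (sub_nonneg.2 ((div_le_one hT).2 h)) (div_nonneg hp hT.le) (by ring)
        simp only [smul_eq_mul, mul_zero, zero_add, Real.exp_zero, mul_one] at h4
        have h5 : p / T * -(α₁ * T) = -(α₁ * p) := by
          field_simp
        rwa [h5] at h4
      have h6 : p / T * (A * (1 - e)) = p / T * C + k * p := by
        rw [hAe]
        field_simp
      have h7 : 0 ≤ p / T * C := by positivity
      nlinarith [mul_le_mul_of_nonneg_left h3 hA0.le]
  have hcross : ∀ x, 0 ≤ x → x ≤ 1 → C * Real.exp (-(α₀ * x)) ≤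
      A - A * Real.exp (-(α₁ * (T + x))) - k * (T + x) := fun x hx hx1 => by
    have h3 : Real.exp (-(α₁ * (T + x))) = e * Real.exp (-(α₁ * x)) := by
      rw [he, ← Real.exp_add]
      ring_nf
    have h4 : α₁ * x ≤ β * (1 - Real.exp (-(α₀ * x))) := by
      rw [hα₀, hα₁, hβ]
      exact mul_le_riskyBeta_mul hR₀ hR (hα₀ ▸ h2) hx hx1
    have h5 : k * x ≤ C * (1 - Real.exp (-(α₀ * x))) := by
      have h6 := mul_le_mul_of_nonneg_left h4 (div_pos hk0 hα₁pos).le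
      have h7 : k / α₁ * (α₁ * x) = k * x := by field_simp
      have h8 : k / α₁ * (β * (1 - Real.exp (-(α₀ * x)))) = C * (1 - Real.exp (-(α₀ * x))) := by
        rw [hCdef]
        ring
      rwa [h7, h8] at h6
    have h9 : Real.exp (-(α₁ * x)) ≤ 1 := Real.exp_le_one_iff.2 (by nlinarith)
    rw [h3]
    nlinarith [mul_nonneg (mul_nonneg hA0.le he0.le) (sub_nonneg.2 h9)]
  have hroot₀ := interruptionExponent_root (R := R₀) (by linarith)
  have hroot₁ := interruptionExponent_root (R := R₁) (by linarith)
  rw [← hα₀] at hroot₀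
  rw [← hα₁] at hroot₁
  have hsuper := fun q (hq : 0 ≤ q) => barrier_renewal_le (R₀ := R₀) (R₁ := R₁) (b := 0)
    (by linarith) hR (by linarith) hk0.le hroot₀ hroot₁ hC hcross hnn zero_le hq
  obtain ⟨F, hFm, hF, hle⟩ := exists_cost_le hX hY hXY
    (c := fun p => ENNReal.ofReal (k * (R₁ - 1)) * (riskyPolicy T p : ℝ≥0∞))
    ((measurable_from_nat.comp (measurable_riskyPolicy T)).const_mul _) (measurable_riskyPolicy T)
    (by linarith) (by linarith) hsuper hD
  have husage : expectedUsage μ X Y (riskyPolicy T) D ≤ ENNReal.ofReal (V D) := by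
    refine le_trans (lintegral_mono_ae ?_) hF
    filter_upwards [hle] with ω hω
    simpa [hkR] using hω
  refine ⟨fun h => husage.trans (le_of_eq ?_), fun h => husage.trans (le_of_eq ?_)⟩
  · rw [hV, barrier_of_ge h, hCdef, hk]
    congr 1
    field_simp
  · rw [hV, barrier_of_le D hC h, hA, hCdef, hk]
    congr 1
    field_simp
    ring

end Risky

/-! ### The threshold -/

section Threshold

variable {R₀ R₁ α₀ α₁ β D ε T : ℝ}

lemma le_one_and_nonneg_of_mem_region (hα₀ : 0 < α₀) (hα : α₀ < α₁)
    (h1 : 1 / α₁ * Real.log (1 / ε) ≤ D) (h2 : D ≤ 1 / α₀ * Real.log (1 / ε)) :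
    ε ≤ 1 ∧ 0 ≤ D := by
  have h3 : 1 / α₁ < 1 / α₀ := one_div_lt_one_div_of_lt hα₀ hα
  have h4 : 0 ≤ Real.log (1 / ε) := by
    by_contra h
    nlinarith
  refine ⟨?_, le_trans (mul_nonneg (by have := hα₀.trans hα; positivity) h4) h1⟩
  rw [one_div, Real.log_inv] at h4
  by_contra h
  linarith [Real.log_pos (not_le.1 h)]

/-- Above the critical buffer size the threshold solves `β exp (-α₀ (D - T) - α₁ T) = ε`. -/
lemma threshold_of_critical_le (hα₀ : 0 < α₀) (hα : α₀ < α₁) (hβ : 1 < β) (hε : 0 < ε)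
    (hcrit : 1 / α₁ * Real.log (β / ε) ≤ D) (h2 : D ≤ 1 / α₀ * Real.log (1 / ε))
    (hT : T = 1 / (α₁ - α₀) * (Real.log (β / ε) - α₀ * D)) :
    0 < T ∧ T ≤ D ∧ (D ≤ 1 / α₁ * Real.log (β / ε) → D ≤ T) ∧
      β * Real.exp (-(α₀ * (D - T))) / (Real.exp (α₁ * T) + β - 1) ≤ ε := by
  have hα₁ : 0 < α₁ := hα₀.trans hα
  have hd : 0 < α₁ - α₀ := sub_pos.2 hα
  have hT' : (α₁ - α₀) * T = Real.log (β / ε) - α₀ * D := by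
    rw [hT]
    field_simp
  have h3 : Real.log (β / ε) ≤ α₁ * D := by
    rwa [one_div, inv_mul_le_iff₀ hα₁] at hcrit
  have h4 : α₀ * D ≤ Real.log (1 / ε) := by
    rwa [one_div, le_inv_mul_iff₀ hα₀] at h2
  have h5 : Real.log (1 / ε) < Real.log (β / ε) :=
    Real.log_lt_log (by positivity) (by gcongr)
  refine ⟨?_, ?_, fun h => ?_, ?_⟩
  · exact pos_of_mul_pos_right (by linarith : 0 < (α₁ - α₀) * T) hd.le
  · exact le_of_mul_le_mul_left (by linarith : (α₁ - α₀) * T ≤ (α₁ - α₀) * D) hd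
  · rw [one_div, le_inv_mul_iff₀ hα₁] at h
    exact le_of_mul_le_mul_left (by linarith : (α₁ - α₀) * D ≤ (α₁ - α₀) * T) hd
  · have h6 : β * Real.exp (-(α₀ * (D - T))) = ε * Real.exp (α₁ * T) := by
      have h7 : -(α₀ * (D - T)) = α₁ * T - Real.log (β / ε) := by linarith
      rw [h7, Real.exp_sub, Real.exp_log (by positivity)]
      field_simp
    rw [h6, div_le_iff₀ (by linarith [Real.exp_pos (α₁ * T)])]
    exact mul_le_mul_of_nonneg_left (by linarith) hε.le

/-- Below the critical buffer size the threshold exceeds the initial buffer size, and the bound on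
the interruption probability holds with room to spare: it would be attained with the
smaller numerator `(β - 1) (1 - ε)` in place of `ε + β (1 - exp (-α₁ D)) - 1`. -/
lemma threshold_of_lt_critical (hα₁ : 0 < α₁) (hβ : 1 < β) (hε : 0 < ε) (hD : 0 ≤ D)
    (hcrit : D < 1 / α₁ * Real.log (β / ε)) (h1 : 1 / α₁ * Real.log (1 / ε) ≤ D)
    (hne : D ≠ 1 / α₁ * Real.log (1 / ε))
    (hT : T = 1 / α₁ * Real.log ((ε + β * (1 - Real.exp (-(α₁ * D))) - 1) /
      (ε - Real.exp (-(α₁ * D))))) (hε1 : ε ≤ 1) :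
    0 < T ∧ D < T ∧
      (β - 1 + Real.exp (α₁ * T) * Real.exp (-(α₁ * D))) / (Real.exp (α₁ * T) + β - 1) ≤ ε := by
  set d := Real.exp (-(α₁ * D)) with hd
  have hlog : Real.log (1 / ε) < α₁ * D := by
    have h := lt_of_le_of_ne h1 hne.symm
    rwa [one_div, inv_mul_lt_iff₀ hα₁] at h
  have hdε : d < ε := by
    rw [hd, ← Real.lt_log_iff_exp_lt hε]
    rw [one_div, Real.log_inv] at hlog
    linarith
  have hβd : ε < β * d := by
    rw [one_div, lt_inv_mul_iff₀ hα₁, Real.lt_log_iff_exp_lt (by positivity),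
      lt_div_iff₀ hε] at hcrit
    have h3 : d * Real.exp (α₁ * D) = 1 := by rw [hd, ← Real.exp_add]; simp
    have h4 := mul_lt_mul_of_pos_left hcrit (Real.exp_pos (-(α₁ * D)))
    rw [← hd, ← mul_assoc, h3] at h4
    linarith
  have hd0 : 0 < d := Real.exp_pos _
  have hd1 : d < 1 := hdε.trans_le hε1
  have hnum : 0 < ε + β * (1 - d) - 1 := by nlinarith
  have hE : Real.exp (α₁ * T) = (ε + β * (1 - d) - 1) / (ε - d) := by
    rw [hT, ← mul_assoc, mul_one_div_cancel hα₁.ne', one_mul,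
      Real.exp_log (div_pos hnum (sub_pos.2 hdε))]
  have hEd : Real.exp (α₁ * T) * (ε - d) = ε + β * (1 - d) - 1 := by
    rw [hE, div_mul_cancel₀ _ (sub_pos.2 hdε).ne']
  have hDT : D < T := by
    have h3 : Real.exp (α₁ * D) < Real.exp (α₁ * T) := by
      rw [hE, lt_div_iff₀ (sub_pos.2 hdε)]
      have h4 : d * Real.exp (α₁ * D) = 1 := by rw [hd, ← Real.exp_add]; simp
      refine lt_of_mul_lt_mul_left ?_ hd0.le
      rw [← mul_assoc, h4, one_mul]
      nlinarith [mul_pos (sub_pos.2 hβd) (sub_pos.2 hd1)]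
    exact lt_of_mul_lt_mul_left (Real.exp_lt_exp.1 h3) hα₁.le
  refine ⟨hD.trans_lt hDT, hDT, ?_⟩
  rw [div_le_iff₀ (by linarith [Real.exp_pos (α₁ * T)])]
  nlinarith

end Threshold

end

theorem mainTheorem7 {Ω : Type*} [MeasurableSpace Ω] (μ : Measure Ω) [IsProbabilityMeasure μ]
    (R₀ R₁ : ℝ) (hR₀ : 1 < R₀) (hR₁ : R₀ < R₁)
    (X Y : ℕ → Ω → ℝ)
    (hX : IsPoissonInterarrival X R₀ μ)
    (hY : IsPoissonInterarrival Y (R₁ - R₀) μ)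
    (hXY : IndepFun (fun ω n => X n ω) (fun ω n => Y n ω) μ)
    (α₀ α₁ β : ℝ)
    (hα₀ : α₀ = interruptionExponent R₀) (hα₁ : α₁ = interruptionExponent R₁)
    (hβ : β = riskyBeta R₀ R₁)
    -- the quantity `log (β / ε)` presupposes that `β` is finite and positive
    (hα₀_lt : α₀ < 2)
    (D ε : ℝ) (hDε : (D, ε) ∈ qoeRegion R₀ R₁)
    (T : ℝ) (hT : T = riskyThreshold R₀ R₁ D ε) :
    (criticalBuffer R₀ R₁ ε ≤ D →
      policyCost μ X Y (riskyPolicy T) D ε ≤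
        ENNReal.ofReal (β / (α₁ * (R₁ - 1)) * Real.exp (-(α₀ * (D - T))))) ∧
    -- on the lower boundary of the region the formula for the threshold divides by zero
    (D ≤ criticalBuffer R₀ R₁ ε → D ≠ 1 / α₁ * Real.log (1 / ε) →
      policyCost μ X Y (riskyPolicy T) D ε ≤
        ENNReal.ofReal ((1 - Real.exp (-(α₁ * D))) /
            ((R₁ - 1) * (1 - Real.exp (-(α₁ * T)))) * (T + 1 + β / α₁) -
          D / (R₁ - 1))) := by
  obtain ⟨hε, h1, h2⟩ := hDε
  simp only at hε h1 h2
  rw [← hα₁] at h1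
  rw [← hα₀] at h2
  have hα₀pos : 0 < α₀ := hα₀ ▸ interruptionExponent_pos hR₀
  have hα : α₀ < α₁ := by
    rw [hα₀, hα₁]
    exact interruptionExponent_lt hR₀ hR₁
  have hβ1 : 1 < β := hβ ▸ one_lt_riskyBeta hR₀ hR₁ (hα₀ ▸ hα₀_lt)
  have hcrit : criticalBuffer R₀ R₁ ε = 1 / α₁ * Real.log (β / ε) := by
    rw [criticalBuffer, ← hα₁, ← hβ]
  rw [riskyThreshold, ← hα₀, ← hα₁, ← hβ, hcrit] at hT
  rw [hcrit]
  have hα₁pos : 0 < α₁ := hα₀pos.trans hα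
  obtain ⟨hε1, hD⟩ := le_one_and_nonneg_of_mem_region hα₀pos hα h1 h2
  have hcost : ∀ {v : ℝ≥0∞}, IsFeasible μ X Y (riskyPolicy T) D ε →
      expectedUsage μ X Y (riskyPolicy T) D ≤ v → policyCost μ X Y (riskyPolicy T) D ε ≤ v :=
    fun hf hv => by rwa [policyCost, if_pos hf]
  have hprob := fun hTpos : 0 < T =>
    interruptionProb_riskyPolicy_le hR₀ hR₁ hX hY hXY hα₀ hα₁ hβ hα₀_lt hTpos hD
  have husage := fun hTpos : 0 < T =>
    expectedUsage_riskyPolicy_le hR₀ hR₁ hX hY hXY hα₀ hα₁ hβ hα₀_lt hTpos hD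
  refine ⟨fun hle => ?_, fun hle hne => ?_⟩
  · rw [if_pos hle] at hT
    obtain ⟨hTpos, hTD, -, hfeas⟩ := threshold_of_critical_le hα₀pos hα hβ1 hε hle h2 hT
    refine hcost ((hprob hTpos).trans ?_) ((husage hTpos).1 hTD)
    rw [if_pos hTD]
    exact ENNReal.ofReal_le_ofReal hfeas
  · have hmain : 0 < T ∧ D ≤ T ∧ IsFeasible μ X Y (riskyPolicy T) D ε := by
      rcases hle.lt_or_eq with hlt | heq
      · rw [if_neg (not_le.2 hlt)] at hT
        obtain ⟨hTpos, hDT, hfeas⟩ :=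
          threshold_of_lt_critical hα₁pos hβ1 hε hD hlt h1 hne hT hε1
        refine ⟨hTpos, hDT.le, (hprob hTpos).trans ?_⟩
        rw [if_neg (not_le.2 hDT)]
        exact ENNReal.ofReal_le_ofReal hfeas
      · rw [if_pos heq.ge] at hT
        obtain ⟨hTpos, hTD, hDT, hfeas⟩ :=
          threshold_of_critical_le hα₀pos hα hβ1 hε heq.ge h2 hT
        refine ⟨hTpos, hDT hle, (hprob hTpos).trans ?_⟩
        rw [if_pos hTD]
        exact ENNReal.ofReal_le_ofReal hfeas
    obtain ⟨hTpos, hDT, hfeas⟩ := hmain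
    refine hcost hfeas (((husage hTpos).2 hDT).trans (ENNReal.ofReal_le_ofReal ?_))
    -- The barrier is smaller than the asserted bound by a nonnegative multiple of `1`.
    have h3 : 0 ≤ 1 - Real.exp (-(α₁ * D)) :=
      sub_nonneg.2 (Real.exp_le_one_iff.2 (neg_nonpos.2 (mul_nonneg hα₁pos.le hD)))
    have h4 : 0 < 1 - Real.exp (-(α₁ * T)) :=
      sub_pos.2 (Real.exp_lt_one_iff.2 (neg_neg_of_pos (mul_pos hα₁pos hTpos)))
    have h5 : 0 < R₁ - 1 := by linarith
    gcongr
    linarith
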